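/- Let $\mathcal H_1\neq\{0\}$ and $\mathcal H_2$ be complex Hilbert spaces (of any dimension) and $\mathcal B(\mathcal H)$ the bounded operators on $\mathcal H$. A *channel* $\mathcal E$ from $\mathcal H_1$ to $\mathcal H_2$ is a trace-preserving completely positive linear map on trace-class operators; equivalently, it is given by its dual $\mathcal E^*:\mathcal B(\mathcal H_2)\to\mathcal B(\mathcal H_1)$, $\operatorname{Tr}(\mathcal E(\rho)A)=\operatorname{Tr}(\rho\,\mathcal E^*(A))$, a normal unital completely positive linear map. A POVM $X$ on a measurable space $\Omega$ with values in $\mathcal B(\mathcal H_1)$ is *correctable* for $\mathcal E$ if there is a channel $\mathcal R$ from $\mathcal H_2$ to $\mathcal H_1$ with $X(\omega)=\mathcal E^*(\mathcal R^*(X(\omega)))$ for all measurable $\omega\subseteq\Omega$. A *sharp observable* is a POVM $X$ on $\mathbb R$ (with its Borel sets) all of whose values $X(\omega)$ are orthogonal projections; it is *represented* by the (possibly unbounded) self-adjoint operator $\widehat X=\int x\,dX(x)$, whose domain is $\{\psi:\int x^2\,d\langle\psi,X(x)\psi\rangle<\infty\}$, so that the $X(\omega)$ are the spectral projections of $\widehat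 X$. Let $\mathcal E$ be a channel from $\mathcal H_1$ to $\mathcal H_2$ with elements $E_i$, that is, $\mathcal E^*(A)=\sum_i E_i^\dagger A E_i$ (weakly) for all $A\in\mathcal B(\mathcal H_2)$, where $(E_i)$ is a countable family of bounded operators $\mathcal H_1\to\mathcal H_2$, and let $$\mathcal A=\{A\in\mathcal B(\mathcal H_1) : [A,E_i^\dagger E_j]=0\text{ for all } i,j\}$$ be its correctable algebra. Let $X$ be a sharp observable on $\mathcal H_1$ represented by the self-adjoint operator $\widehat X$. 1. If $\widehat X$ is bounded, then $X$ is correctable for $\mathcal E$ if and only if $\widehat X\in\mathcal A$. 2. In general, $X$ is correctable for $\mathcal E$ if and only if $\widehat X$ is affiliated with $\mathcal A$, i.e. $T\widehat X\subseteq\widehat X T$ for every $T\in\mathcal B(\mathcal H_1)$ that commutes with all elements of $\mathcal A$. -/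

import Mathlib

open MeasureTheory
open scoped InnerProductSpace CStarAlgebra

noncomputable section

namespace QEC

section Channels

variable {H₁ H₂ : Type*}
  [NormedAddCommGroup H₁] [InnerProductSpace ℂ H₁] [CompleteSpace H₁]
  [NormedAddCommGroup H₂] [InnerProductSpace ℂ H₂] [CompleteSpace H₂]

/-- A normal state on `B(H)`: a functional `A ↦ Tr(ρ A)` with `ρ` a positive trace-class operator
of trace one. Such `ρ` are exactly the sums `∑ₙ |ψₙ⟩⟨ψₙ|` with `∑ₙ ‖ψₙ‖² = 1`, and then
`Tr(ρ A) = ∑ₙ ⟨ψₙ, A ψₙ⟩`. -/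
def IsNormalState (s : (H₁ →L[ℂ] H₁) → ℂ) : Prop :=
  ∃ ψ : ℕ → H₁, HasSum (fun n => ‖ψ n‖ ^ 2) 1 ∧
    ∀ A : H₁ →L[ℂ] H₁, HasSum (fun n => ⟪ψ n, A (ψ n)⟫_ℂ) (s A)

variable (H₁ H₂) in
/-- A quantum channel from the system `H₁` to the system `H₂`, given by its dual (Heisenberg)
map `B(H₂) → B(H₁)`: linear, completely positive, unital (the dual of being trace-preserving), and
the dual of a map on trace-class operators, that is, precomposition with it takes the states
`A ↦ Tr(ρ A)` of `H₁` to states `A ↦ Tr(ρ' A)` of `H₂`. -/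
structure Channel where
  dual : (H₂ →L[ℂ] H₂) →CP (H₁ →L[ℂ] H₁)
  unital : dual 1 = 1
  normal : ∀ s : (H₁ →L[ℂ] H₁) → ℂ, IsNormalState s → IsNormalState (fun A => s (dual A))

/-- The operators `E k : H₁ → H₂` are the elements of the channel in operator-sum form:
`𝓔*(A) = ∑ₖ Eₖ† A Eₖ`, with convergence in the weak sense. -/
def Channel.HasElements {ι : Type*} (𝓔 : Channel H₁ H₂) (E : ι → H₁ →L[ℂ] H₂) : Prop :=
  ∀ (A : H₂ →L[ℂ] H₂) (φ ψ : H₁),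
    HasSum (fun k => ⟪φ, ((E k).adjoint ∘L A ∘L E k) ψ⟫_ℂ) ⟪φ, 𝓔.dual A ψ⟫_ℂ

/-- The correctable algebra: the commutant in `B(H₁)` of the operators `Eᵢ† Eⱼ`. -/
def correctableAlgebra {ι : Type*} (E : ι → H₁ →L[ℂ] H₂) : Set (H₁ →L[ℂ] H₁) :=
  Set.centralizer {T | ∃ i j, T = (E i).adjoint ∘L E j}

end Channels

section Observables

variable {H : Type*} [NormedAddCommGroup H] [InnerProductSpace ℂ H] [CompleteSpace H]

/-- A positive operator valued measure on `Ω`; only the values at measurable sets are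
meaningful. -/
structure POVM (Ω : Type*) [MeasurableSpace Ω] (H : Type*)
    [NormedAddCommGroup H] [InnerProductSpace ℂ H] [CompleteSpace H] where
  effect : Set Ω → (H →L[ℂ] H)
  nonneg : ∀ s, MeasurableSet s → 0 ≤ effect s
  univ : effect Set.univ = 1
  iUnion : ∀ s : ℕ → Set Ω, (∀ n, MeasurableSet (s n)) → Pairwise (Function.onFun Disjoint s) →
    ∀ ψ : H, HasSum (fun n => ⟪ψ, effect (s n) ψ⟫_ℂ) ⟪ψ, effect (⋃ n, s n) ψ⟫_ℂ

namespace POVM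

variable {Ω : Type*} [MeasurableSpace Ω]

/-- An observable is sharp when all of its effects are orthogonal projections. -/
def IsSharp (X : POVM Ω H) : Prop :=
  ∀ s, MeasurableSet s → IsStarProjection (X.effect s)

theorem inner_nonneg (X : POVM Ω H) (ψ : H) {s : Set Ω} (hs : MeasurableSet s) :
    0 ≤ (⟪ψ, X.effect s ψ⟫_ℂ).re := by
  have h := (ContinuousLinearMap.nonneg_iff_isPositive _).1 (X.nonneg s hs)
  exact h.re_inner_nonneg_right ψ

theorem inner_empty (X : POVM Ω H) (ψ : H) : ⟪ψ, X.effect ∅ ψ⟫_ℂ = 0 := by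
  have h := X.iUnion (fun _ => ∅) (fun _ => MeasurableSet.empty)
    (fun i j _ => by simp [Function.onFun]) ψ
  exact (summable_const_iff _).1 h.summable

/-- The distribution `ω ↦ ⟨ψ, X(ω) ψ⟩` of the outcomes, for the vector `ψ`. -/
def distribution (X : POVM Ω H) (ψ : H) : Measure Ω :=
  Measure.ofMeasurable (fun s _ => ENNReal.ofReal (⟪ψ, X.effect s ψ⟫_ℂ).re)
    (by simp [X.inner_empty ψ])
    (by
      intro s hs hd
      have h := Complex.hasSum_re (X.iUnion s hs hd ψ)
      rw [← ENNReal.ofReal_tsum_of_nonneg (fun n => X.inner_nonneg ψ (hs n)) h.summable,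
        h.tsum_eq])

/-- The (possibly unbounded) operator `Xhat` represents the observable `X` on the real line:
`Xhat = ∫ x dX(x)`, with domain `{ψ : ∫ x² d⟨ψ, X(x) ψ⟩ < ∞}` and
`⟨ψ, Xhat ψ⟩ = ∫ x d⟨ψ, X(x) ψ⟩` there. -/
structure IsRepresentedBy (X : POVM ℝ H) (Xhat : H →ₗ.[ℂ] H) : Prop where
  mem_domain_iff : ∀ ψ : H, ψ ∈ Xhat.domain ↔ Integrable (fun x : ℝ => x ^ 2) (X.distribution ψ)
  inner_apply : ∀ ψ : Xhat.domain,
    ⟪(ψ : H), Xhat ψ⟫_ℂ = ((∫ x : ℝ, x ∂(X.distribution (ψ : H)) : ℝ) : ℂ)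

/-- `X` is correctable for the channel `𝓔` when one channel `𝓡` satisfies
`X(ω) = 𝓔*(𝓡*(X(ω)))` for all measurable `ω`. -/
def IsCorrectable {H' : Type*} [NormedAddCommGroup H'] [InnerProductSpace ℂ H'] [CompleteSpace H']
    (X : POVM Ω H) (𝓔 : Channel H H') : Prop :=
  ∃ 𝓡 : Channel H' H, ∀ s, MeasurableSet s → X.effect s = 𝓔.dual (𝓡.dual (X.effect s))

end POVM

/-- A possibly unbounded operator `Xhat` is affiliated with the von Neumann algebra `𝓐` when
`T Xhat ⊆ Xhat T` for all `T` in the commutant of `𝓐`. -/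
def IsAffiliated (Xhat : H →ₗ.[ℂ] H) (𝓐 : Set (H →L[ℂ] H)) : Prop :=
  ∀ T ∈ Set.centralizer 𝓐, ∀ ψ : Xhat.domain,
    ∃ h : T (ψ : H) ∈ Xhat.domain, Xhat ⟨T (ψ : H), h⟩ = T (Xhat ψ)

end Observables

end QEC

end

/-! Both parts reduce to the spectral projections `P = X(ω)`: `POVM.IsSharp.isCorrectable_iff` shows
that correctability means that all of them lie in 𝒜, and `POVM.IsRepresentedBy.isAffiliated_iff`
shows the same for affiliation. For bounded operators affiliation is membership, because 𝒜 is a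
commutant and so equals its bicommutant.

If `P = 𝓔*(B)` with `B = 𝓡*(P)`, then `0 ≤ B ≤ 1`. Positivity of the terms in the operator sum makes
`B` vanish on `Eᵢ(ker P)` and `1 - B` vanish on `Eᵢ(ran P)`. Thus `B Eᵢ = Eᵢ P`, and `Eᵢ†Eⱼ P = Eᵢ†
B Eⱼ = P Eᵢ†Eⱼ`.

Conversely, each projection `P` in 𝒜 lifts to a projection `p` on `H₂` with `p Eᵢ = Eᵢ P`. The
weighted column `G = (cᵢ Eᵢ†)ᵢ` turns `p` into `P` on every component, and so does the partial
isometry `W` of its polar decomposition. The components of `W`, completed on its kernel, are the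
elements of a single channel 𝓡 with `𝓡*(P) Eᵢ = Eᵢ P` for all these `P` at once
(`exists_recovery_channel`), hence `𝓔*(𝓡*(P)) = P`.

For affiliation, commuting with all `X(ω)` passes to `Xhat` by polarizing the distributions.
Conversely, an operator commuting with `Xhat` has no matrix elements between separated spectral
subspaces, by a norm contraction (`effect_apply_effect_eq_zero`); it therefore preserves those of
closed intervals, and together with its adjoint it commutes with all spectral projections. -/

noncomputable section

namespace QEC

/-! ### Columns of operators into a Hilbert sum. -/

section Column

variable {κ H H' : Type*}
  [NormedAddCommGroup H] [InnerProductSpace ℂ H]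
  [NormedAddCommGroup H'] [InnerProductSpace ℂ H']

/-- The column operator `ψ ↦ (Uₖ ψ)ₖ` into the Hilbert sum of copies of `H'`. -/
def column (U : κ → H →L[ℂ] H') (C : ℝ)
    (hU : ∀ ψ, ∃ a, HasSum (fun k => ‖U k ψ‖ ^ 2) a ∧ a ≤ (C * ‖ψ‖) ^ 2) :
    H →L[ℂ] lp (fun _ : κ => H') 2 :=
  LinearMap.mkContinuous
    { toFun := fun ψ => ⟨fun k => U k ψ, by
        obtain ⟨a, ha, -⟩ := hU ψ
        exact memℓp_gen (by simpa using ha.summable)⟩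
      map_add' := fun φ ψ => by ext k; exact map_add (U k) φ ψ
      map_smul' := fun c ψ => by ext k; exact map_smul (U k) c ψ } |C| (by
    intro ψ
    obtain ⟨a, ha, hle⟩ := hU ψ
    have hn := lp.norm_rpow_eq_tsum (p := 2) (by norm_num)
      (⟨fun k => U k ψ, memℓp_gen (by simpa using ha.summable)⟩ : lp (fun _ : κ => H') 2)
    simp only [ENNReal.toReal_ofNat, Real.rpow_ofNat, ha.tsum_eq] at hn
    have hle' := hle
    rw [← hn] at hle'
    have := sq_le_sq.1 hle'
    rwa [abs_norm, abs_mul, abs_norm] at this)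

end Column

theorem hasSum_norm_sq_lp {κ H' : Type*} [NormedAddCommGroup H'] (f : lp (fun _ : κ => H') 2) :
    HasSum (fun k => ‖f k‖ ^ 2) (‖f‖ ^ 2) := by
  simpa using lp.hasSum_norm (p := 2) (by norm_num) f

/-! ### Complete positivity from Gram sums. -/

section CompletelyPositive

/-- Take `c = a⁻` and `d = √(a⁻) a⁻`: both sides are minus the cube of `a⁻`. This lets positivity be
tested on compressions. -/
theorem exists_star_mul_mul_eq_neg {B : Type*} [CStarAlgebra B] [PartialOrder B]
    [StarOrderedRing B] {a : B} (ha : IsSelfAdjoint a) :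
    ∃ c d : B, star c * a * c = -(star d * d) ∧ (d = 0 → 0 ≤ a) := by
  have hc0 : 0 ≤ a⁻ := CFC.negPart_nonneg a
  have hcs : star a⁻ = a⁻ := (IsSelfAdjoint.of_nonneg hc0)
  have hes : star (CFC.sqrt a⁻) = CFC.sqrt a⁻ := (IsSelfAdjoint.of_nonneg (CFC.sqrt_nonneg _))
  have hee : CFC.sqrt a⁻ * CFC.sqrt a⁻ = a⁻ := CFC.sqrt_mul_sqrt_self _
  refine ⟨a⁻, CFC.sqrt a⁻ * a⁻, ?_, fun h => ?_⟩
  · have h1 : a⁻ * a = -(a⁻ * a⁻) := by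
      conv_lhs => rhs; rw [← CFC.posPart_sub_negPart a ha]
      rw [mul_sub, CFC.negPart_mul_posPart, zero_sub]
    rw [hcs, h1, star_mul, hes, hcs, neg_mul, mul_assoc a⁻ (CFC.sqrt a⁻),
      ← mul_assoc (CFC.sqrt a⁻) (CFC.sqrt a⁻), hee, mul_assoc]
  · have hcc : a⁻ * a⁻ = 0 := by
      conv_lhs => lhs; rw [← hee]
      rw [mul_assoc, h, mul_zero]
    rw [CStarAlgebra.nonneg_iff_isSelfAdjoint_and_negPart_eq_zero]
    exact ⟨ha, CStarRing.star_mul_self_eq_zero_iff _ |>.1 (by rw [hcs, hcc])⟩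

theorem exists_eq_star_mul_self_of_nonneg {B : Type*} [CStarAlgebra B] [PartialOrder B]
    [StarOrderedRing B] {a : B} (ha : 0 ≤ a) : ∃ b, a = star b * b :=
  CStarAlgebra.nonneg_iff_eq_star_mul_self.1 ha

/-- A self-adjoint matrix over a C⋆-algebra all of whose compressions `∑ xⱼ⋆ Mⱼₖ xₖ` are positive
is positive. -/
theorem cstarMatrix_nonneg_of_compression {A : Type*} [CStarAlgebra A] [PartialOrder A]
    [StarOrderedRing A] {n : Type*} [Fintype n] [DecidableEq n] {M : CStarMatrix n n A}
    (hM : IsSelfAdjoint M)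
    (h : ∀ x : n → A, 0 ≤ ∑ j, ∑ k, star (x j) * M j k * x k) : 0 ≤ M := by
  obtain ⟨c, d, hcd, hd⟩ := exists_star_mul_mul_eq_neg hM
  -- Diagonal entries of `star c * M * c` are compressions of `M` by columns of `c`, hence
  -- nonnegative; those of `-(star d * d)` are nonpositive. So every entry of `d` vanishes.
  refine hd (CStarMatrix.ext fun i j => ?_)
  have h1 : 0 ≤ (star c * M * c) j j := by
    have := h (fun k => c k j)
    rw [Finset.sum_comm] at this
    simpa [CStarMatrix.mul_apply, CStarMatrix.star_apply, Finset.sum_mul] using this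
  rw [hcd] at h1
  have h2 : ∑ l, star (d l j) * d l j ≤ 0 := by
    have : (-(star d * d)) j j = -∑ l, star (d l j) * d l j := by
      rw [CStarMatrix.neg_apply, CStarMatrix.mul_apply]; rfl
    rw [this] at h1
    exact neg_nonneg.1 h1
  have h3 := Finset.single_le_sum (f := fun l => star (d l j) * d l j)
    (fun l _ => star_mul_self_nonneg (d l j)) (Finset.mem_univ i)
  have h4 := le_antisymm (h3.trans h2) (star_mul_self_nonneg _)
  exact CStarRing.star_mul_self_eq_zero_iff _ |>.1 h4

/-- A linear map is completely positive as soon as `∑ xⱼ⋆ f(aⱼ⋆ aₖ) xₖ ≥ 0` for all `a`, `x`. -/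
def completelyPositiveOfGram {A B : Type*} [CStarAlgebra A] [PartialOrder A]
    [StarOrderedRing A] [CStarAlgebra B] [PartialOrder B] [StarOrderedRing B] (f : A →ₗ[ℂ] B)
    (hstar : ∀ a, f (star a) = star (f a))
    (h : ∀ (n : ℕ) (a : Fin n → A) (x : Fin n → B),
      0 ≤ ∑ j, ∑ k, star (x j) * f (star (a j) * a k) * x k) : A →CP B where
  toLinearMap := f
  map_cstarMatrix_nonneg' n M hM := by
    obtain ⟨N, rfl⟩ := exists_eq_star_mul_self_of_nonneg hM
    refine cstarMatrix_nonneg_of_compression ?_ ?_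
    · have hs : star (star N * N) = star N * N := by simp
      refine CStarMatrix.ext fun i j => ?_
      conv_rhs => rw [CStarMatrix.map_apply, ← hs, CStarMatrix.star_apply]
      rw [CStarMatrix.star_apply, CStarMatrix.map_apply]
      exact (hstar _).symm
    · intro x
      have : ∀ j k, star (x j) * (star N * N).map f j k * x k =
          ∑ l, star (x j) * f (star (N l j) * N l k) * x k := by
        intro j k
        rw [CStarMatrix.map_apply, CStarMatrix.mul_apply, map_sum, Finset.mul_sum, Finset.sum_mul]
        rfl
      change 0 ≤ ∑ j, ∑ k, star (x j) * (star N * N).map f j k * x k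
      simp only [this]
      -- With the row index `l` of `N` outermost, each summand is the hypothesis for the row `N l`.
      rw [Finset.sum_congr rfl fun j _ => Finset.sum_comm, Finset.sum_comm]
      exact Finset.sum_nonneg fun l _ => h n (N l) x

end CompletelyPositive

/-! ### Channels built from their elements. -/

theorem inner_self_eq_ofReal_norm_sq {H : Type*} [NormedAddCommGroup H] [InnerProductSpace ℂ H]
    (v : H) : ⟪v, v⟫_ℂ = ((‖v‖ ^ 2 : ℝ) : ℂ) := by
  rw [inner_self_eq_norm_sq_to_K, Complex.ofReal_pow]; rfl

/-- Summability leaves only countably many nonzero vectors; these are injected into ℕ and padded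
with zeros. -/
theorem isNormalState_of_hasSum {α H₁ : Type*} [NormedAddCommGroup H₁]
    [InnerProductSpace ℂ H₁] {s : (H₁ →L[ℂ] H₁) → ℂ} (u : α → H₁)
    (h1 : HasSum (fun i => ‖u i‖ ^ 2) 1)
    (hs : ∀ A : H₁ →L[ℂ] H₁, HasSum (fun i => ⟪u i, A (u i)⟫_ℂ) (s A)) : IsNormalState s := by
  have hc : (Function.support u).Countable :=
    h1.summable.countable_support.mono fun i hi => by simpa using hi
  have : Countable (Function.support u) := hc
  obtain ⟨f, hf⟩ := exists_injective_nat (Function.support u)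
  have key : ∀ {M : Type} [AddCommMonoid M] [TopologicalSpace M] (g : H₁ → M) (a : M), g 0 = 0 →
      HasSum (fun i => g (u i)) a →
      HasSum (fun n => g (Function.extend f (fun i => u i) 0 n)) a := by
    intro M _ _ g a hg h
    have h' : HasSum (fun i : Function.support u => g (u i)) a := by
      rw [← hasSum_subtype_iff_of_support_subset (s := Function.support u)] at h
      · exact h
      · intro i hi hu
        exact hi (by simp only [hu, hg])
    rw [← hasSum_extend_zero hf] at h'
    convert h' using 2 with n
    by_cases hn : ∃ i, f i = n
    · obtain ⟨i, rfl⟩ := hn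
      rw [hf.extend_apply, hf.extend_apply]
    · rw [Function.extend_apply' _ _ _ hn, Function.extend_apply' _ _ _ hn]
      simp [hg]
  exact ⟨_, key (fun x => ‖x‖ ^ 2) 1 (by simp) h1,
    fun A => key (fun x => ⟪x, A x⟫_ℂ) _ (by simp) (hs A)⟩

section OfElements

variable {κ H₁ H₂ : Type*}
  [NormedAddCommGroup H₁] [InnerProductSpace ℂ H₁] [CompleteSpace H₁]
  [NormedAddCommGroup H₂] [InnerProductSpace ℂ H₂] [CompleteSpace H₂]

variable (V : κ → H₁ →L[ℂ] H₂) (hV : ∀ ψ, HasSum (fun k => ‖V k ψ‖ ^ 2) (‖ψ‖ ^ 2))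

/-- The operator `∑ₖ Vₖ† A Vₖ`, for a family with `∑ₖ Vₖ† Vₖ = 1`. -/
def operatorSum (A : H₂ →L[ℂ] H₂) : H₁ →L[ℂ] H₁ :=
  -- Writing the sum as `V† (A V)` with two bounded columns avoids any convergence of an operator
  -- series.
  (column V 1 fun ψ => ⟨_, hV ψ, by simp⟩).adjoint ∘L
    column (fun k => A ∘L V k) ‖A‖ fun ψ => by
      have hle : ∀ k, ‖(A ∘L V k) ψ‖ ^ 2 ≤ ‖A‖ ^ 2 * ‖V k ψ‖ ^ 2 := fun k => by
        rw [← mul_pow]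
        exact pow_le_pow_left₀ (norm_nonneg _) (A.le_opNorm _) 2
      have hs := (hV ψ).mul_left (‖A‖ ^ 2)
      have hsum := Summable.of_nonneg_of_le (fun k => by positivity) hle hs.summable
      exact ⟨_, hsum.hasSum, by rw [mul_pow]; exact hasSum_le hle hsum.hasSum hs⟩

theorem hasSum_inner_operatorSum (A : H₂ →L[ℂ] H₂) (φ ψ : H₁) :
    HasSum (fun k => ⟪V k φ, A (V k ψ)⟫_ℂ) ⟪φ, operatorSum V hV A ψ⟫_ℂ := by
  rw [operatorSum, ContinuousLinearMap.comp_apply, ContinuousLinearMap.adjoint_inner_right]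
  exact lp.hasSum_inner (𝕜 := ℂ) _ _

theorem operatorSum_eq_of_hasSum {A : H₂ →L[ℂ] H₂} {B : H₁ →L[ℂ] H₁}
    (h : ∀ φ ψ, HasSum (fun k => ⟪V k φ, A (V k ψ)⟫_ℂ) ⟪φ, B ψ⟫_ℂ) : operatorSum V hV A = B := by
  ext ψ
  exact ext_inner_left ℂ fun φ => (hasSum_inner_operatorSum V hV A φ ψ).unique (h φ ψ)

theorem operatorSum_one : operatorSum V hV 1 = 1 := by
  have h1 : ∀ ψ : H₁, ⟪operatorSum V hV 1 ψ, ψ⟫_ℂ = ⟪(1 : H₁ →L[ℂ] H₁) ψ, ψ⟫_ℂ := by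
    intro ψ
    have h := (hasSum_inner_operatorSum V hV 1 ψ ψ)
    have h2 := (hV ψ).mapL Complex.ofRealCLM
    have : ⟪ψ, operatorSum V hV 1 ψ⟫_ℂ = ⟪ψ, ψ⟫_ℂ := by
      refine h.unique ?_
      simp only [one_apply_eq_self, inner_self_eq_norm_sq_to_K]
      simpa using h2
    rw [← inner_conj_symm, this, inner_conj_symm]; rfl
  have h2 := (ext_inner_map (operatorSum V hV 1 : H₁ →ₗ[ℂ] H₁) 1).1 h1
  exact ContinuousLinearMap.coe_injective h2

/-- `operatorSum` as a linear map of the operator. -/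
def operatorSumLinear : (H₂ →L[ℂ] H₂) →ₗ[ℂ] (H₁ →L[ℂ] H₁) where
  toFun := operatorSum V hV
  map_add' A B := operatorSum_eq_of_hasSum V hV fun φ ψ => by
    simpa [inner_add_right] using
      (hasSum_inner_operatorSum V hV A φ ψ).add (hasSum_inner_operatorSum V hV B φ ψ)
  map_smul' c A := operatorSum_eq_of_hasSum V hV fun φ ψ => by
    simpa [inner_smul_right] using (hasSum_inner_operatorSum V hV A φ ψ).mul_left c

theorem operatorSum_star (A : H₂ →L[ℂ] H₂) :
    operatorSum V hV (star A) = star (operatorSum V hV A) :=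
  operatorSum_eq_of_hasSum V hV fun φ ψ => by
    rw [ContinuousLinearMap.star_eq_adjoint, ContinuousLinearMap.star_eq_adjoint,
      ContinuousLinearMap.adjoint_inner_right, ← inner_conj_symm]
    have h := (hasSum_inner_operatorSum V hV A ψ φ).mapL (Complex.conjCLE : ℂ →L[ℝ] ℂ)
    refine (h.congr_fun ?_)
    intro k
    simp [ContinuousLinearMap.adjoint_inner_right]

/-- The quadratic form at `ψ` is `∑ᵢ ‖∑ⱼ aⱼ Vᵢ xⱼ ψ‖²`. -/
theorem operatorSum_gram_nonneg {n : ℕ} (a : Fin n → H₂ →L[ℂ] H₂) (x : Fin n → H₁ →L[ℂ] H₁) :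
    0 ≤ ∑ j, ∑ k, star (x j) * operatorSum V hV (star (a j) * a k) * x k := by
  rw [ContinuousLinearMap.nonneg_iff_isPositive, ContinuousLinearMap.isPositive_iff_complex]
  intro ψ
  set T := ∑ j, ∑ k, star (x j) * operatorSum V hV (star (a j) * a k) * x k
  have hT : HasSum (fun i => (‖∑ j, a j (V i (x j ψ))‖ ^ 2 : ℝ)) (⟪T ψ, ψ⟫_ℂ).re ∧
      (⟪T ψ, ψ⟫_ℂ).im = 0 := by
    have h : HasSum (fun i => (((‖∑ j, a j (V i (x j ψ))‖ ^ 2 : ℝ)) : ℂ)) ⟪ψ, T ψ⟫_ℂ := by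
      have h0 : HasSum (fun i => ∑ j, ∑ k, ⟪V i (x j ψ), (star (a j) * a k) (V i (x k ψ))⟫_ℂ)
          (∑ j, ∑ k, ⟪x j ψ, operatorSum V hV (star (a j) * a k) (x k ψ)⟫_ℂ) :=
        hasSum_sum fun j _ => hasSum_sum fun k _ => hasSum_inner_operatorSum V hV _ _ _
      convert h0 using 1
      · ext i
        rw [← inner_self_eq_ofReal_norm_sq, sum_inner]
        refine Finset.sum_congr rfl fun j _ => ?_
        rw [inner_sum]
        refine Finset.sum_congr rfl fun k _ => ?_
        rw [mul_apply_eq_comp, ContinuousLinearMap.star_eq_adjoint,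
          ContinuousLinearMap.adjoint_inner_right]
      · simp only [T, sum_apply, inner_sum]
        refine Finset.sum_congr rfl fun j _ => Finset.sum_congr rfl fun k _ => ?_
        rw [mul_apply_eq_comp, mul_apply_eq_comp,
          ContinuousLinearMap.star_eq_adjoint, ContinuousLinearMap.adjoint_inner_right]
    rw [← inner_conj_symm, Complex.conj_re, Complex.conj_im]
    refine ⟨by simpa only [Complex.ofReal_re] using Complex.hasSum_re h, ?_⟩
    have := (Complex.hasSum_im h)
    simp only [Complex.ofReal_im] at this
    rw [this.unique hasSum_zero, neg_zero]
  exact ⟨Complex.ext (by simp) (by simp [hT.2]), hT.1.nonneg fun i => by positivity⟩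

/-- The channel with elements `Vₖ`, where `∑ₖ Vₖ† Vₖ = 1`. -/
def Channel.ofElements : Channel H₁ H₂ where
  dual := completelyPositiveOfGram (operatorSumLinear V hV) (operatorSum_star V hV)
    fun _ => operatorSum_gram_nonneg V hV
  unital := operatorSum_one V hV
  normal := by
    rintro s ⟨ψ, h1, hs⟩
    -- The image state is the mixture of the vectors `Vₖ ψₙ`, indexed by the pairs `(n, k)`.
    have hp : HasSum (fun i : ℕ × κ => ‖V i.2 (ψ i.1)‖ ^ 2) 1 := by
      have hsm : Summable (fun i : ℕ × κ => ‖V i.2 (ψ i.1)‖ ^ 2) := by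
        rw [summable_prod_of_nonneg (fun i => by positivity)]
        refine ⟨fun n => (hV (ψ n)).summable, ?_⟩
        simpa only [(hV _).tsum_eq] using h1.summable
      have := hsm.hasSum.prod_fiberwise fun n => hV (ψ n)
      rw [← this.unique h1]
      exact hsm.hasSum
    refine isNormalState_of_hasSum (fun i : ℕ × κ => V i.2 (ψ i.1)) hp fun A => ?_
    have hsm : Summable (fun i : ℕ × κ => ⟪V i.2 (ψ i.1), A (V i.2 (ψ i.1))⟫_ℂ) := by
      refine Summable.of_norm_bounded (hp.summable.mul_left ‖A‖) fun i => ?_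
      refine (norm_inner_le_norm _ _).trans ?_
      calc _ ≤ ‖V i.2 (ψ i.1)‖ * (‖A‖ * ‖V i.2 (ψ i.1)‖) := by gcongr; exact A.le_opNorm _
        _ = _ := by ring
    have h2 := hsm.hasSum.prod_fiberwise fun n => hasSum_inner_operatorSum V hV A (ψ n) (ψ n)
    have h3 := h2.unique (hs (operatorSum V hV A))
    exact h3 ▸ hsm.hasSum

end OfElements

/-! ### Polar decomposition. -/

section Polar

variable {H L : Type*}
  [NormedAddCommGroup H] [InnerProductSpace ℂ H] [CompleteSpace H]
  [NormedAddCommGroup L] [InnerProductSpace ℂ L] [CompleteSpace L]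

theorem topologicalClosure_range_of_isSelfAdjoint {S : H →L[ℂ] H} (hS : IsSelfAdjoint S) :
    S.range.topologicalClosure = S.kerᗮ := by
  rw [ContinuousLinearMap.orthogonal_ker, ← ContinuousLinearMap.star_eq_adjoint, hS.star_eq]

/-- Operators that agree on the range and on the kernel of a self-adjoint operator are equal. -/
theorem eq_of_eq_range_of_eq_ker {S : H →L[ℂ] H} (hS : IsSelfAdjoint S) {M : Type*}
    [NormedAddCommGroup M] [InnerProductSpace ℂ M] {A B : H →L[ℂ] M}
    (hr : ∀ φ, A (S φ) = B (S φ)) (hk : ∀ φ, S φ = 0 → A φ = B φ) : A = B := by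
  ext φ
  rw [← S.ker.starProjection_add_starProjection_orthogonal φ, map_add, map_add]
  congr 1
  · exact hk _ (LinearMap.mem_ker.1 (S.ker.starProjection_apply_mem φ))
  · have hmem : S.kerᗮ.starProjection φ ∈ S.range.topologicalClosure := by
      rw [topologicalClosure_range_of_isSelfAdjoint hS]
      exact Submodule.starProjection_apply_mem _ _
    have hcl : IsClosed {x | A x = B x} := isClosed_eq A.continuous B.continuous
    refine (closure_minimal ?_ hcl) hmem
    rintro _ ⟨x, rfl⟩
    exact hr x

/-- Polar decomposition `G = W S`, where `S = (G† G)^(1/2)` and `W` is a partial isometry with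
the same kernel as `S`. -/
theorem exists_polar_decomposition (G : H →L[ℂ] L) :
    ∃ (S : H →L[ℂ] H) (W : H →L[ℂ] L), IsSelfAdjoint S ∧
      (∀ p, Commute (G.adjoint ∘L G) p → Commute S p) ∧ (∀ φ, ‖S φ‖ = ‖G φ‖) ∧
      (∀ φ, W (S φ) = G φ) ∧ ∀ φ, ‖W φ‖ = ‖S.kerᗮ.starProjection φ‖ := by
  set N : H →L[ℂ] H := G.adjoint ∘L G with hN
  have hN0 : 0 ≤ N := by
    rw [ContinuousLinearMap.nonneg_iff_isPositive]
    exact ContinuousLinearMap.isPositive_adjoint_comp_self G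
  set S : H →L[ℂ] H := CFC.sqrt N with hSdef
  have hS : IsSelfAdjoint S := IsSelfAdjoint.of_nonneg (CFC.sqrt_nonneg N)
  have hSS : S * S = N := CFC.sqrt_mul_sqrt_self N
  have hnorm : ∀ φ, ‖S φ‖ = ‖G φ‖ := by
    intro φ
    have h : ⟪S φ, S φ⟫_ℂ = ⟪G φ, G φ⟫_ℂ := by
      rw [← ContinuousLinearMap.adjoint_inner_right, ← ContinuousLinearMap.star_eq_adjoint,
        hS.star_eq, ← mul_apply_eq_comp, hSS, hN, ContinuousLinearMap.comp_apply,
        ContinuousLinearMap.adjoint_inner_right]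
    rw [@norm_eq_sqrt_re_inner ℂ, h, ← @norm_eq_sqrt_re_inner ℂ]
  have hSmem : ∀ φ, S φ ∈ S.kerᗮ := fun φ => by
    rw [← topologicalClosure_range_of_isSelfAdjoint hS]
    exact Submodule.le_topologicalClosure _ ⟨φ, rfl⟩
  -- `e` is `S` with values in `(ker S)ᗮ`, where its range is dense; `W₀` is the isometric extension
  -- of `S φ ↦ G φ`.
  set e : H →ₗ[ℂ] S.kerᗮ := (S : H →ₗ[ℂ] H).codRestrict S.kerᗮ hSmem with he
  have hdense : DenseRange e := by
    intro x
    have hx : (x : H) ∈ closure (Set.range S) := by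
      have := (topologicalClosure_range_of_isSelfAdjoint hS).ge x.2
      exact this
    rw [closure_subtype]
    convert hx using 2
    ext y
    constructor
    · rintro ⟨_, ⟨z, rfl⟩, rfl⟩
      exact ⟨z, rfl⟩
    · rintro ⟨z, rfl⟩
      exact ⟨e z, ⟨z, rfl⟩, rfl⟩
  have hen : ∀ φ, ‖(G : H →ₗ[ℂ] L) φ‖ ≤ 1 * ‖e φ‖ := fun φ => by
    rw [one_mul]
    exact (hnorm φ).ge
  set W₀ : S.kerᗮ →L[ℂ] L := (G : H →ₗ[ℂ] L).extendOfNorm e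
  have hW₀ : ∀ φ, W₀ (e φ) = G φ := LinearMap.extendOfNorm_eq hdense ⟨1, hen⟩
  have hW₀n : ∀ x, ‖W₀ x‖ = ‖x‖ := by
    intro x
    refine isClosed_property hdense
      (isClosed_eq (W₀.continuous.norm) continuous_norm) (fun φ => ?_) x
    rw [hW₀, ← hnorm]; rfl
  refine ⟨S, W₀ ∘L S.kerᗮ.orthogonalProjectionOnto, hS, fun p hp => ?_, hnorm, fun φ => ?_,
    fun φ => ?_⟩
  · rw [hSdef, CFC.sqrt]
    exact hp.cfcₙ_nnreal _
  · rw [ContinuousLinearMap.comp_apply, ← hW₀]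
    congr 1
    exact Submodule.orthogonalProjectionOnto_mem_subspace_eq_self (e φ)
  · rw [ContinuousLinearMap.comp_apply, hW₀n]; rfl

end Polar

/-! ### Construction of the recovery channel. -/

section Intertwine

variable {ι H₁ H₂ : Type*}
  [NormedAddCommGroup H₁] [InnerProductSpace ℂ H₁] [CompleteSpace H₁]
  [NormedAddCommGroup H₂] [InnerProductSpace ℂ H₂] [CompleteSpace H₂]

theorem mem_correctableAlgebra_iff {E : ι → H₁ →L[ℂ] H₂} {A : H₁ →L[ℂ] H₁} :
    A ∈ correctableAlgebra E ↔
      ∀ i j, (E i).adjoint ∘L E j ∘L A = A ∘L (E i).adjoint ∘L E j := by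
  constructor
  · exact fun h i j => h _ ⟨i, j, rfl⟩
  · rintro h _ ⟨i, j, rfl⟩
    exact h i j

/-- A projection of the correctable algebra lifts to a projection `p` with `p Eⱼ = Eⱼ P`. -/
theorem exists_isSelfAdjoint_intertwine {E : ι → H₁ →L[ℂ] H₂} {P : H₁ →L[ℂ] H₁}
    (hP : IsStarProjection P) (hPA : P ∈ correctableAlgebra E) :
    ∃ p : H₂ →L[ℂ] H₂, IsSelfAdjoint p ∧ ∀ j, p ∘L E j = E j ∘L P := by
  set M : Submodule ℂ H₂ := Submodule.span ℂ {v | ∃ j φ, v = E j (P φ)} with hM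
  refine ⟨M.topologicalClosure.starProjection, isSelfAdjoint_starProjection _, fun j => ?_⟩
  ext φ
  rw [ContinuousLinearMap.comp_apply, ContinuousLinearMap.comp_apply]
  refine Submodule.eq_starProjection_of_mem_orthogonal
    (M.le_topologicalClosure (Submodule.subset_span ⟨j, φ, rfl⟩)) ?_
  -- Orthogonality holds on generators: `⟨Eᵢ P χ, Eⱼ (1 - P) φ⟩ = ⟨χ, P Eᵢ†Eⱼ (1 - P) φ⟩ = 0`, as
  -- `P` commutes with `Eᵢ†Eⱼ`.
  rw [Submodule.orthogonal_closure, hM, Submodule.mem_orthogonal]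
  intro u hu
  induction hu using Submodule.span_induction with
  | mem x hx =>
    obtain ⟨i, χ, rfl⟩ := hx
    have h1 := congrArg (fun T : H₁ →L[ℂ] H₁ => T φ) (mem_correctableAlgebra_iff.1 hPA i j)
    have hPP : ∀ ψ, P (P ψ) = P ψ := fun ψ =>
      congrArg (fun T : H₁ →L[ℂ] H₁ => T ψ) hP.isIdempotentElem.eq
    have hPs : ∀ ψ χ, ⟪P ψ, χ⟫_ℂ = ⟪ψ, P χ⟫_ℂ := fun ψ χ => by
      rw [← ContinuousLinearMap.adjoint_inner_right, ← ContinuousLinearMap.star_eq_adjoint,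
        hP.isSelfAdjoint.star_eq]
    simp only [ContinuousLinearMap.comp_apply] at h1
    rw [← ContinuousLinearMap.adjoint_inner_right, map_sub, hPs, h1, map_sub, hPP, sub_self,
      inner_zero_right]
  | zero => simp
  | add x y _ _ hx hy => rw [inner_add_left, hx, hy, add_zero]
  | smul c x _ hx => rw [inner_smul_left, hx, mul_zero]

end Intertwine

/-- A countable family of operators becomes a bounded column after multiplication by suitable
positive weights. -/
theorem exists_pos_weights {ι H₁ H₂ : Type*} [Countable ι]
    [NormedAddCommGroup H₁] [InnerProductSpace ℂ H₁] [NormedAddCommGroup H₂]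
    [InnerProductSpace ℂ H₂] (F : ι → H₁ →L[ℂ] H₂) :
    ∃ c : ι → ℝ, (∀ i, 0 < c i) ∧ ∀ ψ, ∃ a,
      HasSum (fun i => ‖((c i : ℂ) • F i) ψ‖ ^ 2) a ∧ a ≤ (1 * ‖ψ‖) ^ 2 := by
  have := Encodable.ofCountable ι
  obtain ⟨d, hd, s, hs, hs1⟩ := posSumOfEncodable one_pos ι
  have hpos : ∀ i, 0 < 1 + ‖F i‖ := fun i => by positivity
  -- The squared norms are dominated by `d i * ‖ψ‖²` and `∑ d i ≤ 1`; the summand `1` guards against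
  -- `F i = 0`.
  refine ⟨fun i => √(d i) / (1 + ‖F i‖), fun i => div_pos (Real.sqrt_pos.2 (hd i)) (hpos i),
    fun ψ => ?_⟩
  have hle : ∀ i, ‖(((√(d i) / (1 + ‖F i‖) : ℝ) : ℂ) • F i) ψ‖ ^ 2 ≤ d i * ‖ψ‖ ^ 2 := by
    intro i
    have h0 : 0 ≤ √(d i) / (1 + ‖F i‖) := div_nonneg (Real.sqrt_nonneg _) (hpos i).le
    rw [smul_apply, norm_smul, Complex.norm_real, Real.norm_of_nonneg h0]
    have h1 : √(d i) / (1 + ‖F i‖) * ‖F i ψ‖ ≤ √(d i) * ‖ψ‖ := by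
      rw [div_mul_eq_mul_div, div_le_iff₀ (hpos i), mul_assoc]
      refine mul_le_mul_of_nonneg_left ?_ (Real.sqrt_nonneg _)
      nlinarith [(F i).le_opNorm ψ, norm_nonneg ψ]
    calc _ ≤ (√(d i) * ‖ψ‖) ^ 2 := pow_le_pow_left₀ (by positivity) h1 2
      _ = d i * ‖ψ‖ ^ 2 := by rw [mul_pow, Real.sq_sqrt (hd i).le]
  have hb := hs.mul_right (‖ψ‖ ^ 2)
  have hsum := Summable.of_nonneg_of_le (fun i => by positivity) hle hb.summable
  refine ⟨_, hsum.hasSum, (hasSum_le hle hsum.hasSum hb).trans ?_⟩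
  rw [one_mul]
  exact mul_le_of_le_one_left (by positivity) hs1

/-- Rank-one operators onto a fixed unit vector whose column is the projection onto `K`. -/
theorem exists_rankOne_family {H₁ H₂ : Type*} [NormedAddCommGroup H₁]
    [InnerProductSpace ℂ H₁] [NormedAddCommGroup H₂] [InnerProductSpace ℂ H₂] [Nontrivial H₁]
    (K : Submodule ℂ H₂) [CompleteSpace K] :
    ∃ (w : Set K) (F : w → H₂ →L[ℂ] H₁), (∀ i, ∀ φ ∈ Kᗮ, F i φ = 0) ∧
      ∀ φ, HasSum (fun i => ‖F i φ‖ ^ 2) (‖K.starProjection φ‖ ^ 2) := by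
  obtain ⟨w, b, -⟩ := exists_hilbertBasis ℂ K
  -- The hypothesis `H₁ ≠ 0` enters here.
  obtain ⟨χ, hχ⟩ := exists_norm_eq H₁ zero_le_one
  refine ⟨w, fun i => (innerSL ℂ (b i : H₂)).smulRight χ, fun i φ hφ => ?_, fun φ => ?_⟩
  · rw [ContinuousLinearMap.smulRight_apply, innerSL_apply_apply, hφ _ (b i).2, zero_smul]
  · have h := hasSum_norm_sq_lp (b.repr (K.orthogonalProjectionOnto φ))
    rw [b.repr.norm_map] at h
    change HasSum _ (‖K.starProjection φ‖ ^ 2) at h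
    convert h using 2 with i
    rw [ContinuousLinearMap.smulRight_apply, innerSL_apply_apply, norm_smul, hχ, mul_one,
      b.repr_apply_apply, Submodule.inner_orthogonalProjectionOnto_eq_of_mem_left]

section Recovery

variable {ι H₁ H₂ : Type*}
  [NormedAddCommGroup H₁] [InnerProductSpace ℂ H₁] [CompleteSpace H₁]
  [NormedAddCommGroup H₂] [InnerProductSpace ℂ H₂] [CompleteSpace H₂]

theorem adjoint_comp_eq_of_isSelfAdjoint {p : H₂ →L[ℂ] H₂} {P : H₁ →L[ℂ] H₁}
    (hp : IsSelfAdjoint p) (hP : IsSelfAdjoint P) {E : H₁ →L[ℂ] H₂} (h : p ∘L E = E ∘L P) :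
    E.adjoint ∘L p = P ∘L E.adjoint := by
  have := congrArg ContinuousLinearMap.adjoint h
  rwa [ContinuousLinearMap.adjoint_comp, ContinuousLinearMap.adjoint_comp,
    ← ContinuousLinearMap.star_eq_adjoint p, ← ContinuousLinearMap.star_eq_adjoint P, hp.star_eq,
    hP.star_eq] at this

/-- There is a family `V` with `∑ₖ Vₖ† Vₖ = 1` such that all `Vₖ Eᵢ` commute with the projections
of the correctable algebra. -/
theorem exists_recovery_elements [Nontrivial H₁] [Countable ι] (E : ι → H₁ →L[ℂ] H₂) :
    ∃ (K : Submodule ℂ H₂) (w : Set K) (V : ι ⊕ w → H₂ →L[ℂ] H₁),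
      (∀ φ, HasSum (fun k => ‖V k φ‖ ^ 2) (‖φ‖ ^ 2)) ∧
      ∀ P ∈ correctableAlgebra E, IsStarProjection P → ∀ k i ψ,
        V k (E i (P ψ)) = P (V k (E i ψ)) := by
  -- The weights make the column of the `Eᵢ†` bounded; being nonzero scalars, they alter neither its
  -- kernel nor its relations with `p` and `P`.
  obtain ⟨c, hc, hG⟩ := exists_pos_weights (fun i => (E i).adjoint)
  obtain ⟨S, W, hS, hcomm, hn, hWS, hWn⟩ := exists_polar_decomposition (column _ 1 hG)
  set G := column _ 1 hG with hGdef
  have hGk : ∀ φ k, G φ k = (c k : ℂ) • (E k).adjoint φ := fun φ k => rfl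
  -- `W† W` is only the projection onto `(ker S)ᗮ`; the family `F` supplies the missing projection
  -- onto `ker S`.
  obtain ⟨w, F, hF0, hF⟩ := exists_rankOne_family (H₁ := H₁) S.ker
  have hWker : ∀ φ, S φ = 0 → W φ = 0 := by
    intro φ hφ
    rw [← norm_eq_zero, hWn, norm_eq_zero, Submodule.starProjection_apply_eq_zero_iff,
      Submodule.orthogonal_orthogonal]
    exact hφ
  refine ⟨S.ker, w, Sum.elim
    (fun k => (lp.evalCLM ℂ (fun _ : ι => H₁) 2 k) ∘L W) F, fun φ => ?_, ?_⟩
  · have h1 : HasSum (fun k => ‖W φ k‖ ^ 2) (‖S.kerᗮ.starProjection φ‖ ^ 2) := by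
      rw [← hWn]
      exact hasSum_norm_sq_lp _
    rw [Submodule.norm_sq_eq_add_norm_sq_starProjection φ S.ker, add_comm]
    exact HasSum.sum h1 (hF φ)
  · intro P hPA hP k i ψ
    obtain ⟨p, hp, hpE⟩ := exists_isSelfAdjoint_intertwine hP hPA
    have hEp : ∀ k φ, (E k).adjoint (p φ) = P ((E k).adjoint φ) := fun k φ =>
      congrArg (fun T : H₂ →L[ℂ] H₁ => T φ)
        (adjoint_comp_eq_of_isSelfAdjoint hp hP.isSelfAdjoint (hpE k))
    have hGp : ∀ φ k, G (p φ) k = P (G φ k) := fun φ k => by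
      rw [hGk, hGk, hEp, map_smul]
    have hpi : ∀ x y, ⟪p x, y⟫_ℂ = ⟪x, p y⟫_ℂ := fun x y => by
      rw [← ContinuousLinearMap.adjoint_inner_right, ← ContinuousLinearMap.star_eq_adjoint,
        hp.star_eq]
    have hPi : ∀ x y, ⟪P x, y⟫_ℂ = ⟪x, P y⟫_ℂ := fun x y => by
      rw [← ContinuousLinearMap.adjoint_inner_right, ← ContinuousLinearMap.star_eq_adjoint,
        hP.isSelfAdjoint.star_eq]
    -- Since `G` carries `p` to `P` on each component and both are self-adjoint, `p` commutes with
    -- `G† G`, hence with its square root.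
    have hSp : Commute S p := by
      refine hcomm p ?_
      ext x
      refine ext_inner_left ℂ fun y => ?_
      simp only [mul_apply_eq_comp, ContinuousLinearMap.comp_apply]
      rw [← hpi, ContinuousLinearMap.adjoint_inner_right, ContinuousLinearMap.adjoint_inner_right]
      have h1 := lp.hasSum_inner (𝕜 := ℂ) (G y) (G (p x))
      simp only [hGp, ← hPi] at h1
      refine h1.unique ?_
      simpa only [hGp] using lp.hasSum_inner (𝕜 := ℂ) (G (p y)) (G x)
    have hSp' : ∀ φ, S (p φ) = p (S φ) := fun φ =>
      congrArg (fun T : H₂ →L[ℂ] H₂ => T φ) hSp.eq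
    rcases k with k | k
    · have key : (lp.evalCLM ℂ (fun _ : ι => H₁) 2 k ∘L W) ∘L p =
          P ∘L (lp.evalCLM ℂ (fun _ : ι => H₁) 2 k ∘L W) := by
        -- On `ran S` the relation is that of `G = W S`; on `ker S`, which `p` preserves, `W`
        -- vanishes.
        refine eq_of_eq_range_of_eq_ker hS (fun φ => ?_) fun φ hφ => ?_
        · simp only [ContinuousLinearMap.comp_apply, ← hSp', hWS]
          exact hGp φ k
        · simp only [ContinuousLinearMap.comp_apply]
          rw [hWker φ hφ, hWker (p φ) (by rw [hSp', hφ, map_zero]), map_zero, map_zero]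
      have h1 := congrArg (fun T : H₁ →L[ℂ] H₂ => T ψ) (hpE i)
      have h2 := congrArg (fun T : H₂ →L[ℂ] H₁ => T (E i ψ)) key
      simp only [ContinuousLinearMap.comp_apply] at h1 h2
      rw [h1] at h2
      exact h2
    · have hEmem : ∀ χ, E i χ ∈ S.kerᗮ := by
        intro χ x hx
        have hx0 : S x = 0 := hx
        have hGx : G x = 0 := by rw [← norm_eq_zero, ← hn, hx0, norm_zero]
        have hEx : (E i).adjoint x = 0 := by
          have := hGk x i
          rw [hGx] at this
          exact (smul_eq_zero.1 this.symm).resolve_left (by exact_mod_cast (hc i).ne')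
        rw [← ContinuousLinearMap.adjoint_inner_left, hEx, inner_zero_left]
      simp only [Sum.elim_inr, hF0 k _ (hEmem _), map_zero]

/-- `∑ₖ Vₖ† P Vₖ Eᵢ = ∑ₖ Vₖ† Vₖ Eᵢ P = Eᵢ P`. -/
theorem exists_recovery_channel [Nontrivial H₁] [Countable ι] (E : ι → H₁ →L[ℂ] H₂) :
    ∃ 𝓡 : Channel H₂ H₁, ∀ P ∈ correctableAlgebra E, IsStarProjection P →
      ∀ i ψ, 𝓡.dual P (E i ψ) = E i (P ψ) := by
  obtain ⟨_, w, V, hV, hcomm⟩ := exists_recovery_elements E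
  refine ⟨Channel.ofElements V hV, fun P hPA hP i ψ => ext_inner_left ℂ fun φ => ?_⟩
  have h := hasSum_inner_operatorSum V hV P φ (E i ψ)
  have h1 := hasSum_inner_operatorSum V hV 1 φ (E i (P ψ))
  rw [operatorSum_one] at h1
  simp only [one_apply_eq_self, hcomm P hPA hP] at h1
  exact h.unique h1

end Recovery

/-! ### Correctability and membership of the effects. -/

section Correctable

variable {ι H₁ H₂ : Type*}
  [NormedAddCommGroup H₁] [InnerProductSpace ℂ H₁] [CompleteSpace H₁]
  [NormedAddCommGroup H₂] [InnerProductSpace ℂ H₂] [CompleteSpace H₂]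

theorem inner_apply_left_of_isSelfAdjoint {P : H₁ →L[ℂ] H₁} (hP : IsSelfAdjoint P) (x y : H₁) :
    ⟪P x, y⟫_ℂ = ⟪x, P y⟫_ℂ := by
  rw [← ContinuousLinearMap.adjoint_inner_right, ← ContinuousLinearMap.star_eq_adjoint,
    hP.star_eq]

theorem apply_apply_of_isStarProjection {P : H₁ →L[ℂ] H₁} (hP : IsStarProjection P) (x : H₁) :
    P (P x) = P x :=
  congrArg (fun T : H₁ →L[ℂ] H₁ => T x) hP.isIdempotentElem.eq

theorem inner_apply_self_of_isStarProjection {P : H₁ →L[ℂ] H₁} (hP : IsStarProjection P) (x : H₁) :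
    ⟪x, P x⟫_ℂ = ((‖P x‖ ^ 2 : ℝ) : ℂ) := by
  rw [← inner_self_eq_ofReal_norm_sq, inner_apply_left_of_isSelfAdjoint hP.isSelfAdjoint,
    apply_apply_of_isStarProjection hP]

/-- A positive operator annihilates the vectors with vanishing expectation. -/
theorem apply_eq_zero_of_inner_eq_zero {B : H₁ →L[ℂ] H₁} (hB : 0 ≤ B) {x : H₁}
    (hx : ⟪x, B x⟫_ℂ = 0) : B x = 0 := by
  obtain ⟨C, rfl⟩ := exists_eq_star_mul_self_of_nonneg hB
  rw [mul_apply_eq_comp, ContinuousLinearMap.star_eq_adjoint,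
    ContinuousLinearMap.adjoint_inner_right, inner_self_eq_zero] at hx
  rw [mul_apply_eq_comp, hx, map_zero]

/-- The nonnegative terms `⟨Eᵢ x, B Eᵢ x⟩` sum to `⟨x, 𝓔*(B) x⟩ = 0`. -/
theorem Channel.HasElements.apply_eq_zero {𝓔 : Channel H₁ H₂} {E : ι → H₁ →L[ℂ] H₂}
    (hE : 𝓔.HasElements E) {B : H₂ →L[ℂ] H₂} (hB : 0 ≤ B) {x : H₁} (hx : 𝓔.dual B x = 0) (i : ι) :
    B (E i x) = 0 := by
  have h := hE B x x
  simp only [hx, inner_zero_right, ContinuousLinearMap.comp_apply,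
    ContinuousLinearMap.adjoint_inner_right] at h
  have hpos := (ContinuousLinearMap.nonneg_iff_isPositive _).1 hB
  have hre := Complex.hasSum_re h
  have hz := (hasSum_zero_iff_of_nonneg fun k => hpos.re_inner_nonneg_right (E k x)).1 hre
  refine apply_eq_zero_of_inner_eq_zero hB (Complex.ext (congrFun hz i) ?_)
  have := hpos.inner_nonneg_right (E i x)
  exact (Complex.le_def.1 this).2.symm

/-- A projection in the image of the unit interval under a channel is in the correctable
algebra. -/
theorem Channel.HasElements.mem_correctableAlgebra {𝓔 : Channel H₁ H₂} {E : ι → H₁ →L[ℂ] H₂}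
    (hE : 𝓔.HasElements E) {B : H₂ →L[ℂ] H₂} (hB : 0 ≤ B) (hB1 : B ≤ 1)
    (hP : IsStarProjection (𝓔.dual B)) : 𝓔.dual B ∈ correctableAlgebra E := by
  -- Split `x` into its parts in `ker P` and `ran P`, where `P = 𝓔*(B)`, and apply the vanishing
  -- lemma to `B` and to `1 - B`.
  have hBE : ∀ i x, B (E i x) = E i (𝓔.dual B x) := by
    intro i x
    have h1 : B (E i (x - 𝓔.dual B x)) = 0 :=
      hE.apply_eq_zero hB (by rw [map_sub, apply_apply_of_isStarProjection hP, sub_self]) i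
    have h2 : (1 - B) (E i (𝓔.dual B x)) = 0 := by
      refine hE.apply_eq_zero (sub_nonneg.2 hB1) ?_ i
      rw [map_sub, 𝓔.unital, sub_apply, one_apply_eq_self, apply_apply_of_isStarProjection hP, sub_self]
    rw [map_sub, map_sub, sub_eq_zero] at h1
    rw [sub_apply, one_apply_eq_self, sub_eq_zero] at h2
    rw [h1, ← h2]
  have hBs : IsSelfAdjoint B := .of_nonneg hB
  rw [mem_correctableAlgebra_iff]
  intro i j
  ext x
  refine ext_inner_left ℂ fun y => ?_
  simp only [ContinuousLinearMap.comp_apply]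
  rw [← hBE, ContinuousLinearMap.adjoint_inner_right,
    ← inner_apply_left_of_isSelfAdjoint hBs, hBE,
    ← inner_apply_left_of_isSelfAdjoint hP.isSelfAdjoint, ContinuousLinearMap.adjoint_inner_right]

/-- A sharp observable is correctable exactly when its effects lie in the correctable algebra. -/
theorem POVM.IsSharp.isCorrectable_iff [Nontrivial H₁] [Countable ι] {Ω : Type*}
    [MeasurableSpace Ω] {X : POVM Ω H₁} (hX : X.IsSharp) {𝓔 : Channel H₁ H₂}
    {E : ι → H₁ →L[ℂ] H₂} (hE : 𝓔.HasElements E) :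
    X.IsCorrectable 𝓔 ↔ ∀ s, MeasurableSet s → X.effect s ∈ correctableAlgebra E := by
  constructor
  · rintro ⟨𝓡, h𝓡⟩ s hs
    have h0 : 0 ≤ 𝓡.dual (X.effect s) := map_nonneg 𝓡.dual (X.nonneg s hs)
    have h1 : 𝓡.dual (X.effect s) ≤ 1 := by
      rw [← 𝓡.unital]
      exact OrderHomClass.mono 𝓡.dual (hX s hs).le_one
    have hP := hX s hs
    rw [h𝓡 s hs] at hP ⊢
    exact hE.mem_correctableAlgebra h0 h1 hP
  · intro h
    obtain ⟨𝓡, h𝓡⟩ := exists_recovery_channel E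
    refine ⟨𝓡, fun s hs => ?_⟩
    ext x
    refine ext_inner_left ℂ fun y => ?_
    -- Both sums have the terms of `∑ᵢ Eᵢ† Eᵢ P`; the second adds up to `P` because 𝓔 is unital.
    have h1 := hE (𝓡.dual (X.effect s)) y x
    have h2 := hE 1 y (X.effect s x)
    simp only [ContinuousLinearMap.comp_apply, ContinuousLinearMap.adjoint_inner_right,
      h𝓡 _ (h s hs) (hX s hs), 𝓔.unital, one_apply_eq_self] at h1 h2
    exact h2.unique h1

end Correctable

/-! ### Calculus of effects and distributions. -/

theorem eq_of_inner_apply_self_eq {H : Type*} [NormedAddCommGroup H]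
    [InnerProductSpace ℂ H] {A B : H →L[ℂ] H} (h : ∀ ψ, ⟪ψ, A ψ⟫_ℂ = ⟪ψ, B ψ⟫_ℂ) :
    A = B := by
  refine ContinuousLinearMap.coe_injective ((ext_inner_map (A : H →ₗ[ℂ] H) B).1 fun ψ => ?_)
  rw [← inner_conj_symm, ContinuousLinearMap.coe_coe, h, inner_conj_symm]
  rfl

section Effects

variable {Ω H : Type*} [MeasurableSpace Ω]
  [NormedAddCommGroup H] [InnerProductSpace ℂ H] [CompleteSpace H]

theorem POVM.effect_union (X : POVM Ω H) {s t : Set Ω} (hs : MeasurableSet s)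
    (ht : MeasurableSet t) (hst : Disjoint s t) :
    X.effect (s ∪ t) = X.effect s + X.effect t := by
  refine eq_of_inner_apply_self_eq fun ψ => ?_
  set f : ℕ → Set Ω := fun n => if n = 0 then s else if n = 1 then t else ∅ with hf
  have hfm : ∀ n, MeasurableSet (f n) := fun n => by
    simp only [hf]
    split_ifs
    exacts [hs, ht, .empty]
  have hU : ⋃ n, f n = s ∪ t := by
    ext x
    simp only [Set.mem_iUnion, Set.mem_union]
    constructor
    · rintro ⟨n, hn⟩
      simp only [hf] at hn
      split_ifs at hn
      exacts [.inl hn, .inr hn, hn.elim]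
    · rintro (h | h)
      exacts [⟨0, by simpa [hf] using h⟩, ⟨1, by simpa [hf] using h⟩]
  have hd : Pairwise (Function.onFun Disjoint f) := by
    intro i j hij
    simp only [Function.onFun, hf]
    split_ifs <;>
      first
      | exact hst
      | exact hst.symm
      | exact Set.empty_disjoint _
      | exact Set.disjoint_empty _
      | omega
  have h := X.iUnion f hfm hd ψ
  rw [hU] at h
  have h2 : HasSum (fun n => ⟪ψ, X.effect (f n) ψ⟫_ℂ)
      (∑ n ∈ Finset.range 2, ⟪ψ, X.effect (f n) ψ⟫_ℂ) := by
    refine hasSum_sum_of_ne_finset_zero fun n hn => ?_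
    have h0 : n ≠ 0 := fun h => hn (by simp [h])
    have h1 : n ≠ 1 := fun h => hn (by simp [h])
    simp [hf, h0, h1, X.inner_empty]
  rw [h.unique h2, Finset.sum_range_succ, Finset.sum_range_one]
  simp [hf]

theorem POVM.effect_empty (X : POVM Ω H) : X.effect ∅ = 0 :=
  eq_of_inner_apply_self_eq fun ψ => by simp [X.inner_empty]

theorem POVM.effect_compl (X : POVM Ω H) {s : Set Ω} (hs : MeasurableSet s) :
    X.effect sᶜ = 1 - X.effect s := by
  rw [eq_sub_iff_add_eq', ← X.effect_union hs hs.compl disjoint_compl_right, Set.union_compl_self,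
    X.univ]

theorem POVM.effect_mono (X : POVM Ω H) {s t : Set Ω} (hs : MeasurableSet s)
    (ht : MeasurableSet t) (hst : s ⊆ t) : X.effect s ≤ X.effect t := by
  have := X.effect_union hs (ht.diff hs) Set.disjoint_sdiff_right
  rw [Set.union_sdiff_cancel hst] at this
  rw [this]
  exact le_add_of_nonneg_right (X.nonneg _ (ht.diff hs))

theorem POVM.hasSum_inner (X : POVM Ω H) {s : ℕ → Set Ω} (hs : ∀ n, MeasurableSet (s n))
    (hd : Pairwise (Function.onFun Disjoint s)) (φ ψ : H) :
    HasSum (fun n => ⟪φ, X.effect (s n) ψ⟫_ℂ) ⟪φ, X.effect (⋃ n, s n) ψ⟫_ℂ := by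
  have hpol : ∀ A : H →L[ℂ] H, ⟪φ, A ψ⟫_ℂ =
      (⟪φ + ψ, A (φ + ψ)⟫_ℂ - ⟪φ - ψ, A (φ - ψ)⟫_ℂ
        - Complex.I * ⟪φ + Complex.I • ψ, A (φ + Complex.I • ψ)⟫_ℂ
        + Complex.I * ⟪φ - Complex.I • ψ, A (φ - Complex.I • ψ)⟫_ℂ) / 4 := by
    intro A
    simp only [map_add, map_sub, map_smul, inner_add_left, inner_add_right, inner_sub_left,
      inner_sub_right, inner_smul_left, inner_smul_right, Complex.conj_I]
    linear_combination (⟪φ, A ψ⟫_ℂ / 2 - ⟪ψ, A φ⟫_ℂ / 2) * Complex.I_sq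
  simp only [hpol]
  exact ((((X.iUnion s hs hd _).sub (X.iUnion s hs hd _)).sub
    ((X.iUnion s hs hd _).mul_left _)).add ((X.iUnion s hs hd _).mul_left _)).div_const _

variable {X : POVM Ω H}

/-- Split `t` along `s`: the two effects lie below `X(s)` and `X(sᶜ) = 1 - X(s)`, and a positive
operator below a projection commutes with it. -/
theorem POVM.IsSharp.commute (hX : X.IsSharp) {s t : Set Ω} (hs : MeasurableSet s)
    (ht : MeasurableSet t) : Commute (X.effect s) (X.effect t) := by
  have h1 : Commute (X.effect s) (X.effect (t ∩ s)) := by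
    have := (hX s hs).mul_right_and_mul_left_of_nonneg_of_le (X.nonneg _ (ht.inter hs))
      (X.effect_mono (ht.inter hs) hs Set.inter_subset_right)
    exact this.2.trans this.1.symm
  have h2 : Commute (X.effect s) (X.effect (t \ s)) := by
    have := (hX _ hs.compl).mul_right_and_mul_left_of_nonneg_of_le (X.nonneg _ (ht.diff hs))
      (X.effect_mono (ht.diff hs) hs.compl fun x hx => hx.2)
    have h3 : Commute (X.effect sᶜ) (X.effect (t \ s)) := this.2.trans this.1.symm
    rw [X.effect_compl hs] at h3
    simpa using (Commute.one_left _).sub_left h3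
  rw [← Set.inter_union_sdiff t s, X.effect_union (ht.inter hs) (ht.diff hs)
    (Set.disjoint_sdiff_inter.symm)]
  exact h1.add_right h2

theorem POVM.IsSharp.distribution_apply (hX : X.IsSharp) (ψ : H) {s : Set Ω}
    (hs : MeasurableSet s) : X.distribution ψ s = ENNReal.ofReal (‖X.effect s ψ‖ ^ 2) := by
  rw [POVM.distribution, Measure.ofMeasurable_apply _ hs,
    inner_apply_self_of_isStarProjection (hX s hs), Complex.ofReal_re]

theorem POVM.IsSharp.distribution_univ (hX : X.IsSharp) (ψ : H) :
    X.distribution ψ Set.univ = ENNReal.ofReal (‖ψ‖ ^ 2) := by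
  rw [hX.distribution_apply ψ .univ, X.univ, one_apply_eq_self]

theorem POVM.IsSharp.isFiniteMeasure (hX : X.IsSharp) (ψ : H) :
    IsFiniteMeasure (X.distribution ψ) :=
  ⟨by rw [hX.distribution_univ]; exact ENNReal.ofReal_lt_top⟩

theorem POVM.IsSharp.distribution_eq_zero_iff (hX : X.IsSharp) (ψ : H) {s : Set Ω}
    (hs : MeasurableSet s) : X.distribution ψ s = 0 ↔ X.effect s ψ = 0 := by
  rw [hX.distribution_apply ψ hs, ENNReal.ofReal_eq_zero]
  constructor
  · intro h
    have := le_antisymm h (sq_nonneg _)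
    simpa using this
  · intro h
    simp [h]

theorem POVM.effect_compl_apply_eq_zero_iff (X : POVM Ω H) (ψ : H) {s : Set Ω}
    (hs : MeasurableSet s) : X.effect sᶜ ψ = 0 ↔ X.effect s ψ = ψ := by
  rw [X.effect_compl hs, sub_apply, one_apply_eq_self, sub_eq_zero, eq_comm]

theorem POVM.IsSharp.ae_mem (hX : X.IsSharp) {ψ : H} {s : Set Ω} (hs : MeasurableSet s)
    (h : X.effect s ψ = ψ) : ∀ᵐ x ∂(X.distribution ψ), x ∈ s :=
  (hX.distribution_eq_zero_iff ψ hs.compl).2 ((X.effect_compl_apply_eq_zero_iff ψ hs).2 h)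

end Effects

/-- The bounded operator `T` maps the domain of `A` to itself and commutes with `A` there. -/
def Intertwines {H : Type*} [NormedAddCommGroup H] [InnerProductSpace ℂ H] (T : H →L[ℂ] H)
    (A : H →ₗ.[ℂ] H) : Prop :=
  ∀ ψ : A.domain, ∃ h : T (ψ : H) ∈ A.domain, A ⟨T (ψ : H), h⟩ = T (A ψ)

theorem norm_add_sq_sub_norm_sub_sq {H : Type*} [NormedAddCommGroup H]
    [InnerProductSpace ℂ H] (x y : H) :
    ‖x + y‖ ^ 2 - ‖x - y‖ ^ 2 = 4 * (⟪x, y⟫_ℂ).re := by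
  rw [@norm_add_sq ℂ, @norm_sub_sq ℂ]
  simp only [RCLike.re_to_complex]
  ring

/-! ### From commuting with the effects to commuting with the operator. -/

section Spectral

variable {H : Type*} [NormedAddCommGroup H] [InnerProductSpace ℂ H] [CompleteSpace H]
  {X : POVM ℝ H} {A : H →ₗ.[ℂ] H}

theorem inner_apply_symm_of_isSelfAdjoint (hA : IsSelfAdjoint A) (φ ψ : A.domain) :
    ⟪A φ, (ψ : H)⟫_ℂ = ⟪(φ : H), A ψ⟫_ℂ := by
  have h := LinearPMap.adjoint_isFormalAdjoint hA.dense_domain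
  rw [LinearPMap.isSelfAdjoint_def.1 hA] at h
  exact h φ ψ

theorem POVM.IsRepresentedBy.integrable_id (hr : X.IsRepresentedBy A) (hX : X.IsSharp)
    (ψ : A.domain) : Integrable (fun x : ℝ => x) (X.distribution (ψ : H)) := by
  have := hX.isFiniteMeasure (ψ : H)
  have h := (hr.mem_domain_iff ψ).1 ψ.2
  have h2 : MemLp (fun x : ℝ => x) 2 (X.distribution (ψ : H)) :=
    (memLp_two_iff_integrable_sq measurable_id.aestronglyMeasurable).2 h
  exact h2.integrable one_le_two

theorem POVM.IsRepresentedBy.re_inner_self (hr : X.IsRepresentedBy A) (ψ : A.domain) :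
    (⟪(ψ : H), A ψ⟫_ℂ).re = ∫ x : ℝ, x ∂(X.distribution (ψ : H)) := by
  rw [hr.inner_apply, Complex.ofReal_re]

theorem POVM.IsRepresentedBy.four_mul_re_inner (hr : X.IsRepresentedBy A)
    (hA : IsSelfAdjoint A) (φ ψ : A.domain) :
    4 * (⟪(φ : H), A ψ⟫_ℂ).re = (∫ x : ℝ, x ∂(X.distribution ((φ : H) + ψ)))
      - ∫ x : ℝ, x ∂(X.distribution ((φ : H) - ψ)) := by
  have h1 := hr.re_inner_self (φ + ψ)
  have h2 := hr.re_inner_self (φ - ψ)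
  have h3 : (⟪(ψ : H), A φ⟫_ℂ).re = (⟪(φ : H), A ψ⟫_ℂ).re := by
    rw [← inner_apply_symm_of_isSelfAdjoint hA, ← inner_conj_symm, Complex.conj_re]
  rw [Submodule.coe_add] at h1
  rw [Submodule.coe_sub] at h2
  rw [← h1, ← h2, LinearPMap.map_add, LinearPMap.map_sub]
  simp only [inner_add_left, inner_add_right, inner_sub_left, inner_sub_right, Complex.add_re,
    Complex.sub_re]
  linarith

theorem commute_adjoint_effect (hX : X.IsSharp) {T : H →L[ℂ] H} {s : Set ℝ}
    (hs : MeasurableSet s) (hT : Commute T (X.effect s)) : Commute T.adjoint (X.effect s) := by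
  have h := hT.star_star
  rwa [(hX s hs).isSelfAdjoint.star_eq] at h

/-- The distribution of `T ψ` is at most `‖T‖²` times that of `ψ`, so its second moment stays
finite. -/
theorem POVM.IsRepresentedBy.apply_mem_domain (hr : X.IsRepresentedBy A) (hX : X.IsSharp)
    {T : H →L[ℂ] H} (hT : ∀ s, MeasurableSet s → Commute T (X.effect s)) {ψ : H}
    (hψ : ψ ∈ A.domain) : T ψ ∈ A.domain := by
  rw [hr.mem_domain_iff] at hψ ⊢
  have hle : X.distribution (T ψ) ≤ ENNReal.ofReal (‖T‖ ^ 2) • X.distribution ψ := by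
    refine Measure.le_iff.2 fun s hs => ?_
    rw [Measure.smul_apply, smul_eq_mul, hX.distribution_apply _ hs, hX.distribution_apply _ hs,
      ← ENNReal.ofReal_mul (by positivity), ← mul_pow]
    have h : X.effect s (T ψ) = T (X.effect s ψ) :=
      (congrArg (fun S : H →L[ℂ] H => S ψ) (hT s hs).eq).symm
    rw [h]
    exact ENNReal.ofReal_le_ofReal (pow_le_pow_left₀ (norm_nonneg _) (T.le_opNorm _) 2)
  exact (hψ.smul_measure ENNReal.ofReal_ne_top).mono_measure hle

theorem POVM.IsRepresentedBy.intertwines (hr : X.IsRepresentedBy A) (hX : X.IsSharp)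
    (hA : IsSelfAdjoint A) {T : H →L[ℂ] H}
    (hT : ∀ s, MeasurableSet s → Commute T (X.effect s)) : Intertwines T A := by
  intro ψ
  have hT' : ∀ s, MeasurableSet s → Commute T.adjoint (X.effect s) :=
    fun s hs => commute_adjoint_effect hX hs (hT s hs)
  have hTψ := hr.apply_mem_domain hX hT ψ.2
  refine ⟨hTψ, ?_⟩
  have key : ∀ φ : A.domain, (⟪(φ : H), A ⟨T ψ, hTψ⟩ - T (A ψ)⟫_ℂ).re = 0 := by
    intro φ
    have hTφ := hr.apply_mem_domain hX hT' φ.2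
    -- This is the polarized form of `⟨φ, X(s) T ψ⟩ = ⟨T†φ, X(s) ψ⟩`, rearranged so that only
    -- positive measures are added.
    have hm : X.distribution ((φ : H) + T ψ) + X.distribution (T.adjoint φ - ψ) =
        X.distribution ((φ : H) - T ψ) + X.distribution (T.adjoint φ + ψ) := by
      refine Measure.ext fun s hs => ?_
      simp only [Measure.add_apply, hX.distribution_apply _ hs]
      rw [← ENNReal.ofReal_add (by positivity) (by positivity),
        ← ENNReal.ofReal_add (by positivity) (by positivity)]
      congr 1
      have e1 : X.effect s (T ψ) = T (X.effect s ψ) :=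
        (congrArg (fun S : H →L[ℂ] H => S ψ) (hT s hs).eq).symm
      have e2 : X.effect s (T.adjoint φ) = T.adjoint (X.effect s φ) :=
        (congrArg (fun S : H →L[ℂ] H => S φ) (hT' s hs).eq).symm
      simp only [map_add, map_sub, e1, e2]
      have h1 := norm_add_sq_sub_norm_sub_sq (X.effect s φ) (T (X.effect s ψ))
      have h2 := norm_add_sq_sub_norm_sub_sq (T.adjoint (X.effect s φ)) (X.effect s ψ)
      rw [ContinuousLinearMap.adjoint_inner_left] at h2
      linarith
    have i1 := hr.four_mul_re_inner hA φ ⟨T ψ, hTψ⟩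
    have i2 := hr.four_mul_re_inner hA ⟨T.adjoint φ, hTφ⟩ ψ
    have h := congrArg (fun μ => ∫ x : ℝ, x ∂μ) hm
    have j1 := hr.integrable_id hX (φ + ⟨T ψ, hTψ⟩)
    have j2 := hr.integrable_id hX (⟨T.adjoint φ, hTφ⟩ - ψ)
    have j3 := hr.integrable_id hX (φ - ⟨T ψ, hTψ⟩)
    have j4 := hr.integrable_id hX (⟨T.adjoint φ, hTφ⟩ + ψ)
    rw [Submodule.coe_add] at j1 j4
    rw [Submodule.coe_sub] at j2 j3
    rw [integral_add_measure j1 j2, integral_add_measure j3 j4] at h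
    rw [ContinuousLinearMap.adjoint_inner_left] at i2
    rw [inner_sub_right, Complex.sub_re]
    linarith
  have hz := hA.dense_domain.closure_eq
  set v := A ⟨T ψ, hTψ⟩ - T (A ψ) with hv
  have hcl : IsClosed {φ : H | (⟪φ, v⟫_ℂ).re = 0} :=
    isClosed_eq (Complex.continuous_re.comp (continuous_id.inner continuous_const))
      continuous_const
  -- Real parts suffice, since by density the test vector may be `v` itself.
  have hall : v ∈ {φ : H | (⟪φ, v⟫_ℂ).re = 0} := by
    refine closure_minimal ?_ hcl (hz ▸ Set.mem_univ v)
    exact fun φ hφ => key ⟨φ, hφ⟩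
  have hall' : (⟪v, v⟫_ℂ).re = 0 := hall
  rw [inner_self_eq_ofReal_norm_sq, Complex.ofReal_re] at hall'
  exact sub_eq_zero.1 (by simpa using hall')

theorem POVM.IsRepresentedBy.intertwines_effect (hr : X.IsRepresentedBy A) (hX : X.IsSharp)
    (hA : IsSelfAdjoint A) {s : Set ℝ} (hs : MeasurableSet s) : Intertwines (X.effect s) A :=
  hr.intertwines hX hA fun _ ht => hX.commute hs ht

theorem POVM.IsRepresentedBy.re_inner_le (hr : X.IsRepresentedBy A) (hX : X.IsSharp)
    {s : Set ℝ} (hs : MeasurableSet s) {b : ℝ} (hb : ∀ x ∈ s, x ≤ b) (ψ : A.domain)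
    (hψ : X.effect s ψ = ψ) : (⟪(ψ : H), A ψ⟫_ℂ).re ≤ b * ‖(ψ : H)‖ ^ 2 := by
  have := hX.isFiniteMeasure (ψ : H)
  rw [hr.re_inner_self]
  calc _ ≤ ∫ _ : ℝ, b ∂(X.distribution (ψ : H)) := by
        refine integral_mono_ae (hr.integrable_id hX ψ) (integrable_const b) ?_
        filter_upwards [hX.ae_mem hs hψ] with x hx using hb x hx
    _ = b * ‖(ψ : H)‖ ^ 2 := by
        rw [integral_const, measureReal_def, hX.distribution_univ,
          ENNReal.toReal_ofReal (by positivity), smul_eq_mul, mul_comm]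

theorem POVM.IsRepresentedBy.le_re_inner (hr : X.IsRepresentedBy A) (hX : X.IsSharp)
    {s : Set ℝ} (hs : MeasurableSet s) {a : ℝ} (ha : ∀ x ∈ s, a ≤ x) (ψ : A.domain)
    (hψ : X.effect s ψ = ψ) : a * ‖(ψ : H)‖ ^ 2 ≤ (⟪(ψ : H), A ψ⟫_ℂ).re := by
  have := hX.isFiniteMeasure (ψ : H)
  rw [hr.re_inner_self]
  calc a * ‖(ψ : H)‖ ^ 2 = ∫ _ : ℝ, a ∂(X.distribution (ψ : H)) := by
        rw [integral_const, measureReal_def, hX.distribution_univ,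
          ENNReal.toReal_ofReal (by positivity), smul_eq_mul, mul_comm]
    _ ≤ _ := by
        refine integral_mono_ae (integrable_const a) (hr.integrable_id hX ψ) ?_
        filter_upwards [hX.ae_mem hs hψ] with x hx using ha x hx

theorem POVM.IsRepresentedBy.effect_apply_mem_domain (hr : X.IsRepresentedBy A) (hX : X.IsSharp)
    {s : Set ℝ} (hs : MeasurableSet s) {C : ℝ} (hC : ∀ x ∈ s, |x| ≤ C) (ψ : H) :
    X.effect s ψ ∈ A.domain := by
  have := hX.isFiniteMeasure (X.effect s ψ)
  rw [hr.mem_domain_iff]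
  refine Integrable.of_bound (by fun_prop) (C ^ 2) ?_
  filter_upwards [hX.ae_mem hs (apply_apply_of_isStarProjection (hX s hs) ψ)] with x hx
  rw [Real.norm_eq_abs, abs_pow]
  exact pow_le_pow_left₀ (abs_nonneg x) (hC x hx) 2

end Spectral

/-- A symmetric operator whose quadratic form is bounded by `r` has norm at most `r`. -/
theorem norm_apply_le_of_abs_re_inner_le {H : Type*} [NormedAddCommGroup H]
    [InnerProductSpace ℂ H] {B : H →ₗ[ℂ] H} (hB : B.IsSymmetric) {r : ℝ} (hr : 0 < r)
    (h : ∀ χ, |(⟪χ, B χ⟫_ℂ).re| ≤ r * ‖χ‖ ^ 2) (ψ : H) : ‖B ψ‖ ≤ r * ‖ψ‖ := by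
  have hpol : ∀ φ : H, 4 * (⟪φ, B ψ⟫_ℂ).re ≤ 2 * r * (‖φ‖ ^ 2 + ‖ψ‖ ^ 2) := by
    intro φ
    have h1 := (abs_le.1 (h (φ + ψ))).2
    have h2 := (abs_le.1 (h (φ - ψ))).1
    have h3 : (⟪ψ, B φ⟫_ℂ).re = (⟪φ, B ψ⟫_ℂ).re := by
      rw [← hB, ← inner_conj_symm, Complex.conj_re]
    have h4 := parallelogram_law_with_norm ℂ φ ψ
    simp only [map_add, map_sub, inner_add_left, inner_add_right, inner_sub_left, inner_sub_right,
      Complex.add_re, Complex.sub_re] at h1 h2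
    nlinarith
  -- The scaling `r⁻¹` balances the two sides and gives `‖B ψ‖² ≤ r² ‖ψ‖²`.
  have h1 := hpol (((r⁻¹ : ℝ) : ℂ) • B ψ)
  rw [inner_smul_left, inner_self_eq_ofReal_norm_sq, Complex.conj_ofReal, ← Complex.ofReal_mul,
    Complex.ofReal_re, norm_smul, Complex.norm_real, Real.norm_of_nonneg (inv_nonneg.2 hr.le)] at h1
  have h2 : ‖B ψ‖ ^ 2 ≤ (r * ‖ψ‖) ^ 2 := by
    have e1 : r * (4 * (r⁻¹ * ‖B ψ‖ ^ 2)) = 4 * ‖B ψ‖ ^ 2 := by field_simp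
    have e2 : r * (2 * r * ((r⁻¹ * ‖B ψ‖) ^ 2 + ‖ψ‖ ^ 2)) = 2 * ‖B ψ‖ ^ 2 + 2 * (r * ‖ψ‖) ^ 2 := by
      field_simp
    have := mul_le_mul_of_nonneg_left h1 hr.le
    rw [e1, e2] at this
    linarith
  exact le_of_sq_le_sq h2 (by positivity)

/-! ### From commuting with the operator to commuting with the effects. -/

section Truncation

variable {H : Type*} [NormedAddCommGroup H] [InnerProductSpace ℂ H]

/-- The operator `(A - c) P`, for `P` with range in the domain of `A`. -/
def truncation (A : H →ₗ.[ℂ] H) (P : H →L[ℂ] H) (hP : ∀ ψ, P ψ ∈ A.domain) (c : ℝ) : H →ₗ[ℂ] H :=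
  A.toFun ∘ₗ (P : H →ₗ[ℂ] H).codRestrict A.domain hP - (c : ℂ) • (P : H →ₗ[ℂ] H)

theorem truncation_apply (A : H →ₗ.[ℂ] H) (P : H →L[ℂ] H) (hP : ∀ ψ, P ψ ∈ A.domain) (c : ℝ)
    (ψ : H) : truncation A P hP c ψ = A ⟨P ψ, hP ψ⟩ - (c : ℂ) • P ψ := rfl

theorem re_inner_sub_smul (φ χ : H) (c : ℝ) :
    (⟪φ, χ - (c : ℂ) • φ⟫_ℂ).re = (⟪φ, χ⟫_ℂ).re - c * ‖φ‖ ^ 2 := by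
  rw [inner_sub_right, inner_smul_right, inner_self_eq_ofReal_norm_sq, ← Complex.ofReal_mul,
    Complex.sub_re, Complex.ofReal_re]

end Truncation

section Spectral

variable {H : Type*} [NormedAddCommGroup H] [InnerProductSpace ℂ H] [CompleteSpace H]
  {X : POVM ℝ H} {A : H →ₗ.[ℂ] H}

theorem POVM.IsRepresentedBy.effect_truncation (hr : X.IsRepresentedBy A) (hX : X.IsSharp)
    (hA : IsSelfAdjoint A) {s : Set ℝ} (hs : MeasurableSet s)
    (hP : ∀ ψ, X.effect s ψ ∈ A.domain) (c : ℝ) (ψ : H) :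
    X.effect s (truncation A (X.effect s) hP c ψ) = truncation A (X.effect s) hP c ψ := by
  obtain ⟨h, h'⟩ := hr.intertwines_effect hX hA hs ⟨X.effect s ψ, hP ψ⟩
  have hPP := apply_apply_of_isStarProjection (hX s hs) ψ
  have hA' : A ⟨_, h⟩ = A ⟨X.effect s ψ, hP ψ⟩ := congrArg A (Subtype.ext hPP)
  rw [truncation_apply, map_sub, map_smul, ← h', hA', hPP]

/-- On the range of `X(s)` the quadratic form of `A - c` lies between `-r` and `r`. -/
theorem POVM.IsRepresentedBy.norm_truncation_le (hr : X.IsRepresentedBy A) (hX : X.IsSharp)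
    (hA : IsSelfAdjoint A) {s : Set ℝ} (hs : MeasurableSet s) {c r : ℝ} (hr0 : 0 < r)
    (hsr : s ⊆ Set.Icc (c - r) (c + r)) (hP : ∀ ψ, X.effect s ψ ∈ A.domain) (ψ : H) :
    ‖truncation A (X.effect s) hP c ψ‖ ≤ r * ‖ψ‖ := by
  have hPs := fun x y => inner_apply_left_of_isSelfAdjoint (hX s hs).isSelfAdjoint x y
  have hPB := hr.effect_truncation hX hA hs hP c
  refine norm_apply_le_of_abs_re_inner_le (fun φ ψ => ?_) hr0 (fun χ => ?_) ψ
  · rw [← hPB φ, ← hPB ψ, hPs, ← hPs φ, truncation_apply, truncation_apply, inner_sub_left,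
      inner_sub_right, inner_smul_left, inner_smul_right, Complex.conj_ofReal]
    congr 1
    exact inner_apply_symm_of_isSelfAdjoint hA ⟨X.effect s φ, hP φ⟩ ⟨X.effect s ψ, hP ψ⟩
  · rw [← hPB, ← hPs, truncation_apply, re_inner_sub_smul]
    have hPP := apply_apply_of_isStarProjection (hX s hs) χ
    have h1 := hr.re_inner_le hX hs (fun x hx => (hsr hx).2) ⟨X.effect s χ, hP χ⟩ hPP
    have h2 := hr.le_re_inner hX hs (fun x hx => (hsr hx).1) ⟨X.effect s χ, hP χ⟩ hPP
    have h3 : ‖X.effect s χ‖ ≤ ‖χ‖ := by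
      have := (X.effect s).le_opNorm χ
      have hn := IsStarProjection.norm_le _ (hX s hs)
      nlinarith [norm_nonneg χ]
    have h4 : r * ‖X.effect s χ‖ ^ 2 ≤ r * ‖χ‖ ^ 2 := by gcongr
    simp only at h1 h2
    rw [abs_le]
    constructor <;> linarith

/-- The form of `A - c` or of `c - A` is at least `r` there; Cauchy–Schwarz does the rest. -/
theorem POVM.IsRepresentedBy.mul_norm_le (hr : X.IsRepresentedBy A) (hX : X.IsSharp)
    {s : Set ℝ} (hs : MeasurableSet s) {c r : ℝ}
    (hsr : (∀ x ∈ s, c + r ≤ x) ∨ ∀ x ∈ s, x ≤ c - r) (ψ : A.domain)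
    (hψ : X.effect s ψ = ψ) : r * ‖(ψ : H)‖ ≤ ‖A ψ - (c : ℂ) • (ψ : H)‖ := by
  have h1 : r * ‖(ψ : H)‖ ^ 2 ≤ |(⟪(ψ : H), A ψ - (c : ℂ) • (ψ : H)⟫_ℂ).re| := by
    rw [re_inner_sub_smul]
    rcases hsr with h | h
    · have := hr.le_re_inner hX hs h ψ hψ
      exact le_trans (by linarith) (le_abs_self _)
    · have := hr.re_inner_le hX hs h ψ hψ
      exact le_trans (by linarith) (neg_le_abs _)
  have h2 := (Complex.abs_re_le_norm _).trans
    (norm_inner_le_norm (𝕜 := ℂ) (ψ : H) (A ψ - (c : ℂ) • (ψ : H)))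
  rcases (norm_nonneg (ψ : H)).eq_or_lt with h0 | h0
  · rw [← h0, mul_zero]
    exact norm_nonneg _
  · refine le_of_mul_le_mul_left ?_ h0
    nlinarith

/-- An operator commuting with `A` has no matrix elements between separated spectral subspaces. -/
theorem POVM.IsRepresentedBy.effect_apply_effect_eq_zero (hr : X.IsRepresentedBy A)
    (hX : X.IsSharp) (hA : IsSelfAdjoint A) {T : H →L[ℂ] H} (hT : Intertwines T A)
    {s t : Set ℝ} (hs : MeasurableSet s) (ht : MeasurableSet t) {c r r' : ℝ} (hr0 : 0 < r)
    (hrr : r < r') (hsr : s ⊆ Set.Icc (c - r) (c + r))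
    (htr : (∀ x ∈ t, c + r' ≤ x) ∨ ∀ x ∈ t, x ≤ c - r') (ψ : H) :
    X.effect t (T (X.effect s ψ)) = 0 := by
  have hP : ∀ ψ, X.effect s ψ ∈ A.domain := hr.effect_apply_mem_domain hX hs (C := |c| + r)
    fun x hx => by
      have h1 := (hsr hx).1
      have h2 := (hsr hx).2
      have h3 := le_abs_self c
      have h4 := neg_abs_le c
      rw [abs_le]
      constructor <;> linarith
  set Z : H →L[ℂ] H := X.effect t ∘L T ∘L X.effect s with hZ
  set B := truncation A (X.effect s) hP c with hB
  -- `(A - c) Z ψ = Z B ψ` gives `r' ‖Z ψ‖ ≤ ‖Z‖ r ‖ψ‖`, so `‖Z‖ ≤ (r / r') ‖Z‖` with ratio below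
  -- one, forcing `Z = 0`.
  have hbound : ∀ ψ, ‖Z ψ‖ ≤ (r / r' * ‖Z‖) * ‖ψ‖ := by
    intro ψ
    obtain ⟨h1, h1'⟩ := hT ⟨X.effect s ψ, hP ψ⟩
    obtain ⟨h2, h2'⟩ := hr.intertwines_effect hX hA ht ⟨_, h1⟩
    have h3 := hr.mul_norm_le hX ht htr ⟨Z ψ, h2⟩ (apply_apply_of_isStarProjection (hX t ht) _)
    have h4 : A ⟨Z ψ, h2⟩ - (c : ℂ) • Z ψ = Z (B ψ) := by
      have e1 : Z (B ψ) = X.effect t (T (B ψ)) := by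
        rw [hZ, ContinuousLinearMap.comp_apply, ContinuousLinearMap.comp_apply,
          hr.effect_truncation hX hA hs hP c ψ]
      rw [e1, hB, truncation_apply, map_sub, map_sub, ← h1', ← h2', map_smul, map_smul]
      rfl
    simp only [h4] at h3
    have h5 := (Z.le_opNorm (B ψ)).trans
      (mul_le_mul_of_nonneg_left (hr.norm_truncation_le hX hA hs hr0 hsr hP ψ) (norm_nonneg Z))
    have hr' : 0 < r' := hr0.trans hrr
    rw [div_mul_eq_mul_div, div_mul_eq_mul_div, le_div_iff₀ hr']
    linarith
  have hr' : 0 < r' := hr0.trans hrr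
  have hZn := Z.opNorm_le_bound (by positivity) hbound
  have hlt : r / r' < 1 := (div_lt_one hr').2 hrr
  have hZ0 : ‖Z‖ = 0 := by nlinarith [norm_nonneg Z]
  have : Z ψ = 0 := by rw [norm_eq_zero.1 hZ0]; rfl
  exact this

/-- The complement of the interval is a countable union of half-lines at positive distance from it.
-/
theorem POVM.IsRepresentedBy.effect_Icc_apply (hr : X.IsRepresentedBy A)
    (hX : X.IsSharp) (hA : IsSelfAdjoint A) {T : H →L[ℂ] H} (hT : Intertwines T A)
    {a b : ℝ} (hab : a ≤ b) (ψ : H) :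
    X.effect (Set.Icc a b) (T (X.effect (Set.Icc a b) ψ)) = T (X.effect (Set.Icc a b) ψ) := by
  rw [← X.effect_compl_apply_eq_zero_iff _ measurableSet_Icc,
    ← hX.distribution_eq_zero_iff _ measurableSet_Icc.compl]
  set μ := X.distribution (T (X.effect (Set.Icc a b) ψ)) with hμ
  have hcov : (Set.Icc a b)ᶜ ⊆ (⋃ n : ℕ, Set.Ici (b + 1 / ((n : ℝ) + 1))) ∪
      ⋃ n : ℕ, Set.Iic (a - 1 / ((n : ℝ) + 1)) := by
    intro x hx
    rw [Set.mem_compl_iff, Set.mem_Icc, not_and_or, not_le, not_le] at hx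
    rcases hx with hx | hx
    · obtain ⟨n, hn⟩ := exists_nat_one_div_lt (sub_pos.2 hx)
      exact .inr (Set.mem_iUnion.2 ⟨n, by rw [Set.mem_Iic]; linarith⟩)
    · obtain ⟨n, hn⟩ := exists_nat_one_div_lt (sub_pos.2 hx)
      exact .inl (Set.mem_iUnion.2 ⟨n, by rw [Set.mem_Ici]; linarith⟩)
  have key : ∀ (n : ℕ) (t : Set ℝ), MeasurableSet t →
      ((∀ x ∈ t, b + 1 / ((n : ℝ) + 1) ≤ x) ∨ ∀ x ∈ t, x ≤ a - 1 / ((n : ℝ) + 1)) → μ t = 0 := by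
    intro n t ht h
    have hn : 0 < 1 / ((n : ℝ) + 1) := by positivity
    rw [hμ, hX.distribution_eq_zero_iff _ ht]
    -- Centre at the midpoint; half the gap is added to the half-length so that `0 < r < r'` even
    -- when `a = b`.
    refine hr.effect_apply_effect_eq_zero hX hA hT measurableSet_Icc ht (c := (a + b) / 2)
      (r := (b - a) / 2 + 1 / ((n : ℝ) + 1) / 2) (r' := (b - a) / 2 + 1 / ((n : ℝ) + 1))
      (by linarith) (by linarith) (fun x hx => ⟨?_, ?_⟩) ?_ ψ
    · linarith [hx.1]
    · linarith [hx.2]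
    · refine h.imp (fun h x hx => ?_) fun h x hx => ?_
      · linarith [h x hx]
      · linarith [h x hx]
  refine measure_mono_null hcov (measure_union_null (measure_iUnion_null fun n => ?_)
    (measure_iUnion_null fun n => ?_))
  · exact key n _ measurableSet_Ici (.inl fun x hx => hx)
  · exact key n _ measurableSet_Iic (.inr fun x hx => hx)

/-- An operator that commutes, together with its adjoint, with `A` commutes with the spectral
projections of `A`. -/
theorem POVM.IsRepresentedBy.commute_effect (hr : X.IsRepresentedBy A)
    (hX : X.IsSharp) (hA : IsSelfAdjoint A) {T : H →L[ℂ] H} (hT : Intertwines T A)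
    (hT' : Intertwines T.adjoint A) {s : Set ℝ} (hs : MeasurableSet s) :
    Commute T (X.effect s) := by
  have hgen : (inferInstance : MeasurableSpace ℝ) =
      .generateFrom {S : Set ℝ | ∃ l u : ℝ, l ≤ u ∧ Set.Icc l u = S} :=
    BorelSpace.measurable_eq.trans (borel_eq_generateFrom_Icc ℝ)
  induction s, hs using MeasurableSpace.induction_on_inter hgen (isPiSystem_Icc id id) with
  | empty => rw [X.effect_empty]; exact Commute.zero_right T
  | basic t ht =>
    obtain ⟨a, b, hab, rfl⟩ := ht
    set P := X.effect (Set.Icc a b) with hP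
    have hPs : IsSelfAdjoint P := (hX _ measurableSet_Icc).isSelfAdjoint
    -- `T` and `T†` both preserve the range of `P`; the adjoint of the second relation gives `P T P
    -- = P T`.
    have h1 : P * T * P = T * P := by
      ext ψ
      exact hr.effect_Icc_apply hX hA hT hab ψ
    have h2 : P * star T * P = star T * P := by
      ext ψ
      exact hr.effect_Icc_apply hX hA hT' hab ψ
    have h3 : P * T * P = P * T := by
      have := congrArg star h2
      simpa [hPs.star_eq, mul_assoc] using this
    exact h1.symm.trans h3
  | compl t ht h =>
    rw [X.effect_compl ht]
    exact (Commute.one_right T).sub_right h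
  | iUnion f hd hf h =>
    ext ψ
    refine ext_inner_left ℂ fun φ => ?_
    have e1 := X.hasSum_inner hf hd φ (T ψ)
    have e2 := X.hasSum_inner hf hd (T.adjoint φ) ψ
    simp only [ContinuousLinearMap.adjoint_inner_left] at e2
    rw [mul_apply_eq_comp, mul_apply_eq_comp]
    refine e2.unique (e1.congr_fun fun n => ?_)
    exact congrArg (fun S : H →L[ℂ] H => ⟪φ, S ψ⟫_ℂ) (h n).eq

end Spectral

/-! ### Affiliation with the correctable algebra. -/

section Affiliation

variable {ι H₁ H₂ : Type*}
  [NormedAddCommGroup H₁] [InnerProductSpace ℂ H₁] [CompleteSpace H₁]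
  [NormedAddCommGroup H₂] [InnerProductSpace ℂ H₂] [CompleteSpace H₂]

theorem centralizer_centralizer_correctableAlgebra (E : ι → H₁ →L[ℂ] H₂) :
    Set.centralizer (Set.centralizer (correctableAlgebra E)) = correctableAlgebra E :=
  Set.centralizer_centralizer_centralizer _

theorem star_mem_correctableAlgebra {E : ι → H₁ →L[ℂ] H₂} {A : H₁ →L[ℂ] H₁}
    (hA : A ∈ correctableAlgebra E) : star A ∈ correctableAlgebra E := by
  refine Set.star_mem_centralizer' ?_ hA
  rintro _ ⟨i, j, rfl⟩
  exact ⟨j, i, by rw [ContinuousLinearMap.star_eq_adjoint, ContinuousLinearMap.adjoint_comp,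
    ContinuousLinearMap.adjoint_adjoint]⟩

/-- A self-adjoint operator is affiliated with the correctable algebra exactly when its spectral
projections belong to it. -/
theorem POVM.IsRepresentedBy.isAffiliated_iff {X : POVM ℝ H₁} {A : H₁ →ₗ.[ℂ] H₁}
    (hr : X.IsRepresentedBy A) (hX : X.IsSharp) (hA : IsSelfAdjoint A) (E : ι → H₁ →L[ℂ] H₂) :
    IsAffiliated A (correctableAlgebra E) ↔
      ∀ s, MeasurableSet s → X.effect s ∈ correctableAlgebra E := by
  constructor
  · intro h s hs
    rw [← centralizer_centralizer_correctableAlgebra]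
    intro T hT
    -- The commutant is closed under adjoints, so affiliation applies to `T` and to `T†`.
    have hT' : star T ∈ Set.centralizer (correctableAlgebra E) :=
      Set.star_mem_centralizer' (fun _ => star_mem_correctableAlgebra) hT
    exact (hr.commute_effect hX hA (h T hT) (h _ hT') hs).eq
  · intro h T hT
    exact hr.intertwines hX hA fun s hs => (hT _ (h s hs)).symm

/-- For bounded operators, affiliation is membership. -/
theorem isAffiliated_toPMap_iff (E : ι → H₁ →L[ℂ] H₂) (A : H₁ →L[ℂ] H₁) :
    IsAffiliated ((A : H₁ →ₗ[ℂ] H₁).toPMap ⊤) (correctableAlgebra E) ↔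
      A ∈ correctableAlgebra E := by
  rw [← centralizer_centralizer_correctableAlgebra E]
  constructor
  · intro h T hT
    ext ψ
    rw [centralizer_centralizer_correctableAlgebra] at h
    obtain ⟨_, h'⟩ := h T hT ⟨ψ, trivial⟩
    exact h'.symm
  · intro h T hT ψ
    rw [centralizer_centralizer_correctableAlgebra] at hT
    exact ⟨trivial, (congrArg (fun S : H₁ →L[ℂ] H₁ => S ψ) (h T hT)).symm⟩

end Affiliation

end QEC

end

theorem mainTheorem3
    {H₁ H₂ : Type*}
    [NormedAddCommGroup H₁] [InnerProductSpace ℂ H₁] [CompleteSpace H₁] [Nontrivial H₁]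
    [NormedAddCommGroup H₂] [InnerProductSpace ℂ H₂] [CompleteSpace H₂]
    {ι : Type*} [Countable ι]
    (𝓔 : QEC.Channel H₁ H₂) (E : ι → H₁ →L[ℂ] H₂) (hE : 𝓔.HasElements E)
    (X : QEC.POVM ℝ H₁) (hX : X.IsSharp)
    (Xhat : H₁ →ₗ.[ℂ] H₁) (hself : IsSelfAdjoint Xhat) (hrep : X.IsRepresentedBy Xhat) :
    (∀ T : H₁ →L[ℂ] H₁, Xhat = (T : H₁ →ₗ[ℂ] H₁).toPMap ⊤ →
      (X.IsCorrectable 𝓔 ↔ T ∈ QEC.correctableAlgebra E)) ∧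
    (X.IsCorrectable 𝓔 ↔ QEC.IsAffiliated Xhat (QEC.correctableAlgebra E)) := by
  have h : X.IsCorrectable 𝓔 ↔ QEC.IsAffiliated Xhat (QEC.correctableAlgebra E) :=
    (hX.isCorrectable_iff hE).trans (hrep.isAffiliated_iff hX hself E).symm
  refine ⟨fun T hT => ?_, h⟩
  rw [h, hT, QEC.isAffiliated_toPMap_iff]
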